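/- **Setting.** Let $n\ge 2$, and put $p=n+1$ if $n$ is odd, $p=n$ if $n$ is even. Let $J=[a,b]$, $a<b$, let $f\in C^{p}(J)$ be real valued, and let $x_i=x_1+(i-1)h$ $(1\le i\le n)$, with $h>0$, be a panel of equally spaced nodes contained in $J$. Let $w_0(t)=1$, $w_i(t)=t(t-h)\cdots(t-(i-1)h)$, and $$I(w_i)=\int_0^{(n-1)h}w_i(t)\,dt,\qquad a_i=I(w_{i-1})\quad(i\ge 1).$$ With $f[\cdot]$ denoting divided differences, put (model A) $$Q_n=a_1f(x_1),\qquad \tilde E_n=\sum_{k=2}^{n}a_k\,f[x_1,\dots,x_k],\qquad S_n=Q_n+\tilde E_n,$$ $$I=\int_{x_1}^{x_n}f(x)\,dx,\qquad g(x,h)=\left|1+\sum_{j=2}^{n-1}\frac{a_{j+1}}{a_2}\,\frac{f^{(j)}(x)}{j!\,f'(x)}\right|.$$ Say that the panel is *admissible* if $f'(x)\ne0$ and $g(x,h)\ge h$ for all $x\in(x_1,x_n)$. Finally let $$\bar E_{S_n}=\frac{I(w_{n+1})}{I(w_1)}\,\frac{f[x_1,\dots,x_n,\bar x_1,\bar x_2]}{f[x_1,x_2]}\,\tilde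 E_n\quad(n\text{ odd}),\qquad \bar E_{S_n}=\frac{I(w_{n})}{I(w_1)}\,\frac{f[x_1,\dots,x_n,\bar x_1]}{f[x_1,x_2]}\,\tilde E_n\quad(n\text{ even}),$$ where $\bar x_1=(x_1+x_2)/2$ and $\bar x_2=(x_{n-1}+x_n)/2$. **Proposition 3.1.** Let $n\ge2$. 1. *(Error bound.)* There is a constant $C>0$ depending only on $n$, and for every real $M$ there is $h_0>0$ depending only on $n$ and $M$, such that for all $J$, all $f\in C^p(J)$ and every admissible panel in $J$ with step $0<h<h_0$ for which $|f^{(p)}(x)|/|f'(x)|\le M$ on $(x_1,x_n)$, one has $\tilde E_n\neq0$, $$|I-S_n|\le C\,h^{n-1}\,M\,|\tilde E_n|\qquad\text{and}\qquad |I-S_n|\le\frac{|I(w_p)|}{p!\;I(w_1)\,h}\,M\,|\tilde E_n| .$$ (For odd $n$ the factor $\frac{|I(w_p)|}{p!\,I(w_1)h}$ is an explicit constant depending only on $n$, times $h^{n-1}$.) 2. *($\tilde E_n$ is a realistic correction for $Q_n$: $|I-S_n|\ll|\tilde E_n|$ for small $h$.)* Let $f\in C^p(J)$ and $x_1\in[a,b)$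 be fixed, and suppose that $f^{(j)}(x_1)\ne0$ for some $1\le j\le p-1$. Then for every $\eta>0$ there is $h_0>0$ such that for every admissible panel in $J$ with first node $x_1$ and step $0<h<h_0$, $$\tilde E_n\ne0\qquad\text{and}\qquad |I-S_n|\le\eta\,|\tilde E_n|.$$ 3. *($\bar E_{S_n}$ estimates the true error of $S_n$.)* Let $f\in C^p(J)$ and $x_1\in[a,b)$ be fixed, and suppose that $f'(x_1)\neq0$. Then for every $\eta>0$ there is $h_0>0$ such that for every admissible panel in $J$ with first node $x_1$ and step $0<h<h_0$, $$|(I-S_n)-\bar E_{S_n}|\le\eta\,h^{p+1}.$$ If moreover $f^{(p)}(x_1)\neq0$, then $h_0$ can be chosen so that also $$|(I-S_n)-\bar E_{S_n}|\le\eta\,|I-S_n|,$$ and $\bar E_{S_n}$ is a realistic error: $I-S_n\neq0$, $\bar E_{S_n}$ has the same sign as $I-S_n$, and if $|I-S_n|=0.d_1d_2\ldots\times10^{-k}$ with first digit $d_1\neq0$, then $\lfloor 10^{k+1}|\bar E_{S_n}|\rfloor\in\{d_1-1,d_1,d_1+1\}$. -/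

import Mathlib

open Set

noncomputable section

namespace ModelA

/-- The `i`-th node (counted from `0`) of the panel with first node `x₁` and step `h`. -/
def node (x₁ h : ℝ) (i : ℕ) : ℝ := x₁ + i * h

/-- The divided difference `f[v 0, v 1, …, v k]`, for distinct nodes, in its explicit symmetric
form `∑ i, f (v i) / ∏ j ≠ i, (v i - v j)`. -/
def divDiff (f : ℝ → ℝ) (v : ℕ → ℝ) (k : ℕ) : ℝ :=
  ∑ i ∈ Finset.range (k + 1),
    f (v i) / ∏ j ∈ (Finset.range (k + 1)).erase i, (v i - v j)

/-- The Newton polynomial `w_i(t) = t (t - h) ⋯ (t - (i - 1) h)`, with `w_0 = 1`. -/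
def newtonPoly (h : ℝ) (i : ℕ) (t : ℝ) : ℝ := ∏ k ∈ Finset.range i, (t - k * h)

/-- `I(w_i)`, the integral of `w_i` over `[0, (n - 1) h]`. -/
def newtonInt (n : ℕ) (h : ℝ) (i : ℕ) : ℝ :=
  ∫ t in (0 : ℝ)..(((n : ℝ) - 1) * h), newtonPoly h i t

/-- The weight `a_i = I(w_{i-1})`, for `1 ≤ i`. -/
def weight (n : ℕ) (h : ℝ) (i : ℕ) : ℝ := newtonInt n h (i - 1)

/-- The left rectangle rule `Q_n(f) = a_1 f(x_1)`. -/
def ruleQ (n : ℕ) (f : ℝ → ℝ) (x₁ h : ℝ) : ℝ := weight n h 1 * f x₁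

/-- The correction `∑_{k=2}^n a_k f[x_1, …, x_k]`. -/
def correction (n : ℕ) (f : ℝ → ℝ) (x₁ h : ℝ) : ℝ :=
  ∑ k ∈ Finset.Icc 2 n, weight n h k * divDiff f (node x₁ h) (k - 1)

/-- The corrected rule `S_n(f)`. -/
def ruleS (n : ℕ) (f : ℝ → ℝ) (x₁ h : ℝ) : ℝ := ruleQ n f x₁ h + correction n f x₁ h

/-- The true error `I(f) - S_n(f)`, where `I(f)` is the integral over the panel `[x_1, x_n]`. -/
def trueError (n : ℕ) (f : ℝ → ℝ) (x₁ h : ℝ) : ℝ :=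
  (∫ x in x₁..(x₁ + ((n : ℝ) - 1) * h), f x) - ruleS n f x₁ h

/-- The order of the derivative in the error formula of `S_n`: `n + 1` for odd `n`,
`n` for even `n`. -/
def errOrder (n : ℕ) : ℕ := if Odd n then n + 1 else n

/-- The function `g(x, h)`; the derivatives are those of `f` on the interval `J`. -/
def gFun (n : ℕ) (f : ℝ → ℝ) (J : Set ℝ) (x h : ℝ) : ℝ :=
  |1 + ∑ j ∈ Finset.Icc 2 (n - 1), (weight n h (j + 1) / weight n h 2) *
      (iteratedDerivWithin j f J x / ((j.factorial : ℝ) * iteratedDerivWithin 1 f J x))|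

/-- The two hypotheses on the panel: on the open interval `(x_1, x_n)` the derivative `f'` has
no zero and `g(x, h) ≥ h`. -/
def PanelCondition (n : ℕ) (f : ℝ → ℝ) (J : Set ℝ) (x₁ h : ℝ) : Prop :=
  (∀ x ∈ Ioo x₁ (x₁ + ((n : ℝ) - 1) * h), iteratedDerivWithin 1 f J x ≠ 0) ∧
  (∀ x ∈ Ioo x₁ (x₁ + ((n : ℝ) - 1) * h), h ≤ gFun n f J x h)

/-- The nodes `x_1, …, x_n` (indices `0, …, n - 1`) followed by the midpoint `(x_1 + x_2) / 2`
(index `n`) and the midpoint `(x_{n-1} + x_n) / 2` (index `n + 1`). -/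
def extNode (n : ℕ) (x₁ h : ℝ) (i : ℕ) : ℝ :=
  if i < n then node x₁ h i
  else if i = n then (node x₁ h 0 + node x₁ h 1) / 2
  else (node x₁ h (n - 2) + node x₁ h (n - 1)) / 2

/-- The computable estimate of the error of `S_n`. With `p = errOrder n` it is
`I(w_p) / I(w_1) * f[extended nodes] / f[x_1, x_2]` times the correction. The `p + 1` extended
nodes are the panel with both midpoints if `n` is odd, and with the first one if `n` is even. -/
def errorEstimate (n : ℕ) (f : ℝ → ℝ) (x₁ h : ℝ) : ℝ :=
  newtonInt n h (errOrder n) / newtonInt n h 1 *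
    (divDiff f (extNode n x₁ h) (errOrder n) / divDiff f (node x₁ h) 1) * correction n f x₁ h

/-- `Ebar` is a realistic approximation of the nonzero number `E`: it has the same sign and, when
`|E| = 0.d₁d₂… × 10 ^ (-k)` with `d₁ ≠ 0`, the number `|Ebar|` written with the same power of ten
has leading part `d₁ - 1`, `d₁` or `d₁ + 1`. Here `Int.log 10 |E| = -(k + 1)`, so that
`d₁ = ⌊|E| / 10 ^ Int.log 10 |E|⌋`. -/
def IsRealisticEstimate (E Ebar : ℝ) : Prop :=
  E ≠ 0 ∧ SignType.sign Ebar = SignType.sign E ∧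
    |⌊|Ebar| / (10 : ℝ) ^ Int.log 10 |E|⌋ - ⌊|E| / (10 : ℝ) ^ Int.log 10 |E|⌋| ≤ 1

end ModelA

end

open Set

noncomputable section

namespace ModelA

open Polynomial Filter Topology

/-! Put `m = n - 1`, `p = errOrder n` and `F t = f (x₁ + h * t)`. Substituting `x = x₁ + h * t`
turns the correction, the true error and the estimate into `h` times the same quantities for `F`
with unit step.

The rule integrates the Newton interpolant, so its error functional kills `w_i` for `i < n`, and by
symmetry also `w_n` for odd `n`. It therefore kills degrees below `p`, and sends a polynomial of
degree at most `p` to its coefficient of order `p` times `I(w_p) ≠ 0` (`trueError_eval`). Error,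
correction and divided differences are bounded by the sup norm on `[0, m]`, so Taylor's formula with
Peano remainder gives their leading terms in `h` (`tendsto_functional_div_pow`). The error has order
`h ^ p`, the correction has the order of the first nonvanishing derivative, and the estimate has the
same leading term as the error. Claims 2 and 3 compare these terms.

Claim 1 must be uniform in `f`, so leading terms at one point do not suffice. Let `B` be the maximum
of `|f'|` on the panel. The remainder bound gives an error `O(M B h ^ p)`, and it remains to bound
`h * B` by the correction. As `f'` has no zero, `f` is monotone, and `∫ F - m * F 0`, which is
correction plus error, controls `|F - F 0|` on half of the panel. Up to the remainder `F` is a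
polynomial of bounded degree, so this controls `F'` on the whole panel, hence `h * B`; the remainder
is absorbed when `M * h` is small (`exists_trueError_bound_correction`). The resulting factor `M h ^
(p - 1)` has one power of `h` more than the explicit constant of the second bound, which follows for
small `h`. -/

/-! ### Reduction to unit step. -/

lemma newtonPoly_scale (h : ℝ) (i : ℕ) (t : ℝ) :
    newtonPoly h i (h * t) = h ^ i * newtonPoly 1 i t := by
  simp only [newtonPoly]
  rw [← Finset.card_range i, ← Finset.prod_const, Finset.card_range, ← Finset.prod_mul_distrib]
  exact Finset.prod_congr rfl fun k _ => by ring

lemma newtonInt_scale (n i : ℕ) (h : ℝ) :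
    newtonInt n h i = h ^ (i + 1) * newtonInt n 1 i := by
  have := intervalIntegral.mul_integral_comp_mul_left (a := 0) (b := (n : ℝ) - 1)
    (f := newtonPoly h i) (c := h)
  simp only [newtonInt, mul_one]
  rw [mul_comm ((n : ℝ) - 1) h, ← mul_zero h, ← this]
  simp only [newtonPoly_scale, mul_zero, intervalIntegral.integral_const_mul]
  ring

lemma node_scale (x h : ℝ) (i : ℕ) : node x h i = x + h * node 0 1 i := by
  simp [node]; ring

lemma extNode_scale (n : ℕ) (x h : ℝ) (i : ℕ) : extNode n x h i = x + h * extNode n 0 1 i := by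
  simp only [extNode, node]
  split_ifs <;> ring

lemma divDiff_affine (f : ℝ → ℝ) (x h : ℝ) (v : ℕ → ℝ) (k : ℕ) :
    divDiff f (fun i => x + h * v i) k = divDiff (fun t => f (x + h * t)) v k / h ^ k := by
  simp only [divDiff, Finset.sum_div]
  refine Finset.sum_congr rfl fun i hi => ?_
  have : ∏ j ∈ (Finset.range (k + 1)).erase i, (x + h * v i - (x + h * v j)) =
      h ^ k * ∏ j ∈ (Finset.range (k + 1)).erase i, (v i - v j) := by
    have hc : ((Finset.range (k + 1)).erase i).card = k := by simp [Finset.card_erase_of_mem hi]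
    rw [show h ^ k = ∏ _j ∈ (Finset.range (k + 1)).erase i, h by rw [Finset.prod_const, hc],
      ← Finset.prod_mul_distrib]
    exact Finset.prod_congr rfl fun j _ => by ring
  rw [this, div_div, mul_comm (h ^ k)]

lemma divDiff_node_scale (f : ℝ → ℝ) (x h : ℝ) (k : ℕ) :
    divDiff f (node x h) k = divDiff (fun t => f (x + h * t)) (node 0 1) k / h ^ k := by
  rw [← divDiff_affine]
  congr 1
  exact funext fun i => node_scale x h i

lemma divDiff_extNode_scale (n : ℕ) (f : ℝ → ℝ) (x h : ℝ) (k : ℕ) :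
    divDiff f (extNode n x h) k =
      divDiff (fun t => f (x + h * t)) (extNode n 0 1) k / h ^ k := by
  rw [← divDiff_affine]
  congr 1
  exact funext fun i => extNode_scale n x h i

lemma correction_scale (n : ℕ) (f : ℝ → ℝ) (x : ℝ) {h : ℝ} (hh : h ≠ 0) :
    correction n f x h = h * correction n (fun t => f (x + h * t)) 0 1 := by
  simp only [correction, Finset.mul_sum]
  refine Finset.sum_congr rfl fun k hk => ?_
  obtain ⟨j, rfl⟩ : ∃ j, k = j + 1 := ⟨k - 1, by have := (Finset.mem_Icc.1 hk).1; omega⟩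
  rw [divDiff_node_scale, weight, weight, newtonInt_scale]
  simp only [Nat.add_sub_cancel]
  field_simp
  ring

lemma weight_one (n : ℕ) (h : ℝ) : weight n h 1 = ((n : ℝ) - 1) * h := by
  simp [weight, newtonInt, newtonPoly]

lemma trueError_scale (n : ℕ) (f : ℝ → ℝ) (x : ℝ) {h : ℝ} (hh : h ≠ 0) :
    trueError n f x h = h * trueError n (fun t => f (x + h * t)) 0 1 := by
  have := intervalIntegral.mul_integral_comp_add_mul (a := 0) (b := (n : ℝ) - 1)
    (f := f) (c := h) (d := x)
  simp only [trueError, ruleS, ruleQ, weight_one, mul_zero, add_zero, mul_one, zero_add] at this ⊢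
  rw [correction_scale n f x hh, mul_comm ((n : ℝ) - 1) h, ← this]
  ring

lemma errorEstimate_scale (n : ℕ) (f : ℝ → ℝ) (x : ℝ) {h : ℝ} (hh : h ≠ 0) :
    errorEstimate n f x h = h * errorEstimate n (fun t => f (x + h * t)) 0 1 := by
  simp only [errorEstimate]
  rw [correction_scale n f x hh, divDiff_node_scale, divDiff_extNode_scale,
    newtonInt_scale n _ h, newtonInt_scale n 1 h]
  field_simp
  ring

/-! ### Divided differences, correction and error as bounded linear functionals. -/

/-- The Newton polynomial with unit step as a polynomial. -/
def newtonPolynomial (i : ℕ) : ℝ[X] := ∏ k ∈ Finset.range i, (X - C (k : ℝ))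

lemma eval_newtonPolynomial (i : ℕ) (t : ℝ) :
    (newtonPolynomial i).eval t = newtonPoly 1 i t := by
  simp [newtonPolynomial, newtonPoly, eval_prod]

lemma monic_newtonPolynomial (i : ℕ) : (newtonPolynomial i).Monic :=
  monic_prod_of_monic _ _ fun _ _ => monic_X_sub_C _

lemma natDegree_newtonPolynomial (i : ℕ) : (newtonPolynomial i).natDegree = i := by
  rw [newtonPolynomial, natDegree_prod_of_monic _ _ fun _ _ => monic_X_sub_C _]
  simp only [natDegree_X_sub_C, Finset.sum_const, Finset.card_range, smul_eq_mul, mul_one]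

lemma coeff_newtonPolynomial_self (i : ℕ) : (newtonPolynomial i).coeff i = 1 := by
  have := (monic_newtonPolynomial i).coeff_natDegree
  rwa [natDegree_newtonPolynomial] at this

lemma newtonPoly_eq_zero {i j : ℕ} (hij : j < i) : newtonPoly 1 i (j : ℝ) = 0 :=
  Finset.prod_eq_zero (Finset.mem_range.2 hij) (by simp)

lemma continuous_newtonPoly (h : ℝ) (i : ℕ) : Continuous (newtonPoly h i) := by
  unfold newtonPoly
  fun_prop

lemma divDiff_eval {v : ℕ → ℝ} {k : ℕ} (hv : InjOn v (Finset.range (k + 1))) {P : ℝ[X]}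
    (hP : P.natDegree ≤ k) : divDiff (fun t => P.eval t) v k = P.coeff k := by
  have hd : P.degree < ((Finset.range (k + 1)).card : ℕ) := by
    rw [Finset.card_range]
    exact lt_of_le_of_lt degree_le_natDegree (by exact_mod_cast Nat.lt_succ_of_le hP)
  have := Lagrange.coeff_eq_sum hv hd
  simp only [Finset.card_range, Nat.add_sub_cancel] at this
  rw [this, divDiff]

lemma divDiff_add (f g : ℝ → ℝ) (v : ℕ → ℝ) (k : ℕ) :
    divDiff (fun t => f t + g t) v k = divDiff f v k + divDiff g v k := by
  simp [divDiff, add_div, Finset.sum_add_distrib]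

lemma divDiff_const_mul (c : ℝ) (f : ℝ → ℝ) (v : ℕ → ℝ) (k : ℕ) :
    divDiff (fun t => c * f t) v k = c * divDiff f v k := by
  simp [divDiff, mul_div_assoc, Finset.mul_sum]

lemma exists_divDiff_bound (v : ℕ → ℝ) (k : ℕ) : ∃ K : ℝ, 0 ≤ K ∧ ∀ (f : ℝ → ℝ) (δ : ℝ),
    (∀ i ≤ k, |f (v i)| ≤ δ) → |divDiff f v k| ≤ K * δ := by
  refine ⟨∑ i ∈ Finset.range (k + 1), |∏ j ∈ (Finset.range (k + 1)).erase i, (v i - v j)|⁻¹,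
    Finset.sum_nonneg fun _ _ => by positivity, fun f δ hf => ?_⟩
  rw [divDiff, Finset.sum_mul]
  refine (Finset.abs_sum_le_sum_abs _ _).trans (Finset.sum_le_sum fun i hi => ?_)
  rw [abs_div, div_eq_mul_inv, mul_comm]
  exact mul_le_mul_of_nonneg_left (hf i (Nat.lt_succ_iff.1 (Finset.mem_range.1 hi)))
    (by positivity)

lemma correction_add (n : ℕ) (f g : ℝ → ℝ) (x h : ℝ) :
    correction n (fun t => f t + g t) x h = correction n f x h + correction n g x h := by
  simp [correction, divDiff_add, mul_add, Finset.sum_add_distrib]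

lemma correction_const_mul (n : ℕ) (c : ℝ) (f : ℝ → ℝ) (x h : ℝ) :
    correction n (fun t => c * f t) x h = c * correction n f x h := by
  simp only [correction, divDiff_const_mul, Finset.mul_sum]
  exact Finset.sum_congr rfl fun _ _ => by ring

lemma node_zero_one (i : ℕ) : node 0 1 i = i := by simp [node]

lemma node_zero_one_mem {n i : ℕ} (hi : i < n) : node 0 1 i ∈ Icc (0 : ℝ) ((n : ℝ) - 1) := by
  rw [node_zero_one]
  refine ⟨by positivity, ?_⟩
  have : ((i + 1 : ℕ) : ℝ) ≤ n := by exact_mod_cast hi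
  push_cast at this
  linarith

lemma injOn_node_zero_one (s : Set ℕ) : InjOn (node 0 1) s := fun i _ j _ hij => by
  simpa [node_zero_one] using hij

lemma exists_correction_bound (n : ℕ) : ∃ K : ℝ, 0 ≤ K ∧ ∀ (f : ℝ → ℝ) (δ : ℝ),
    (∀ t ∈ Icc (0 : ℝ) ((n : ℝ) - 1), |f t| ≤ δ) → |correction n f 0 1| ≤ K * δ := by
  choose K hK0 hK using exists_divDiff_bound (node 0 1)
  refine ⟨∑ k ∈ Finset.Icc 2 n, |weight n 1 k| * K (k - 1),
    Finset.sum_nonneg fun k _ => mul_nonneg (abs_nonneg _) (hK0 _), fun f δ hf => ?_⟩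
  rw [correction, Finset.sum_mul]
  refine (Finset.abs_sum_le_sum_abs _ _).trans (Finset.sum_le_sum fun k hk => ?_)
  rw [abs_mul, mul_assoc]
  refine mul_le_mul_of_nonneg_left (hK _ f δ fun i hi => hf _ (node_zero_one_mem ?_))
    (abs_nonneg _)
  have := Finset.mem_Icc.1 hk
  omega

/-- For `i ≤ k` this is the coefficient of order `k` of a monic polynomial of degree `i`; for `i >
k` every node involved is a zero of `w_i`. -/
lemma divDiff_newtonPoly (i k : ℕ) :
    divDiff (newtonPoly 1 i) (node 0 1) k = if i = k then 1 else 0 := by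
  rcases le_or_gt i k with hik | hik
  · have := divDiff_eval (v := node 0 1) (k := k) (injOn_node_zero_one _)
      (P := newtonPolynomial i) ((natDegree_newtonPolynomial i).trans_le hik)
    simp only [eval_newtonPolynomial] at this
    rw [this]
    split_ifs with h
    · rw [← h, coeff_newtonPolynomial_self]
    · exact coeff_eq_zero_of_natDegree_lt (by rw [natDegree_newtonPolynomial]; omega)
  · rw [if_neg (by omega), divDiff]
    refine Finset.sum_eq_zero fun j hj => ?_
    rw [node_zero_one, newtonPoly_eq_zero, zero_div]
    have := Finset.mem_range.1 hj
    omega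

lemma correction_newtonPoly (n i : ℕ) :
    correction n (newtonPoly 1 i) 0 1 = if 1 ≤ i ∧ i < n then newtonInt n 1 i else 0 := by
  simp only [correction, divDiff_newtonPoly, mul_ite, mul_one, mul_zero]
  split_ifs with h
  · rw [Finset.sum_eq_single (i + 1)]
    · simp [weight]
    · intro k hk hne
      have := (Finset.mem_Icc.1 hk).1
      exact if_neg (by omega)
    · intro hk
      exact absurd (Finset.mem_Icc.2 ⟨by omega, by omega⟩) hk
  · refine Finset.sum_eq_zero fun k hk => if_neg ?_
    have := Finset.mem_Icc.1 hk
    omega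

lemma trueError_zero_one (n : ℕ) (f : ℝ → ℝ) : trueError n f 0 1 =
    (∫ t in (0 : ℝ)..((n : ℝ) - 1), f t) - ((n : ℝ) - 1) * f 0 - correction n f 0 1 := by
  simp only [trueError, ruleS, ruleQ, weight_one, mul_one, zero_add]
  ring

/-- The rule reproduces the integral of `w_i` for `i < n`, and for `i ≥ n` it returns `0` because
`w_i` vanishes at all nodes. -/
lemma trueError_newtonPoly {n : ℕ} (hn : 0 < n) (i : ℕ) :
    trueError n (newtonPoly 1 i) 0 1 = if i < n then 0 else newtonInt n 1 i := by
  have hI : (∫ t in (0 : ℝ)..((n : ℝ) - 1), newtonPoly 1 i t) = newtonInt n 1 i := by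
    simp [newtonInt]
  rw [trueError_zero_one, hI, correction_newtonPoly]
  rcases Nat.eq_zero_or_pos i with rfl | hi
  · simp [newtonInt, newtonPoly, hn]
  · have : newtonPoly 1 i 0 = 0 := by exact_mod_cast newtonPoly_eq_zero hi
    rw [this]
    by_cases h : i < n
    · simp [h, show 1 ≤ i from hi]
    · simp [h]

lemma trueError_add (n : ℕ) {f g : ℝ → ℝ} (hf : ContinuousOn f (Icc 0 ((n : ℝ) - 1)))
    (hg : ContinuousOn g (Icc 0 ((n : ℝ) - 1))) (hn : 1 ≤ n) :
    trueError n (fun t => f t + g t) 0 1 = trueError n f 0 1 + trueError n g 0 1 := by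
  have h1 : (0 : ℝ) ≤ (n : ℝ) - 1 := by
    have : (1 : ℝ) ≤ n := by exact_mod_cast hn
    linarith
  rw [← uIcc_of_le h1] at hf hg
  simp only [trueError_zero_one, correction_add]
  rw [intervalIntegral.integral_add hf.intervalIntegrable hg.intervalIntegrable]
  ring

lemma trueError_const_mul (n : ℕ) (c : ℝ) (f : ℝ → ℝ) :
    trueError n (fun t => c * f t) 0 1 = c * trueError n f 0 1 := by
  simp only [trueError_zero_one, correction_const_mul, intervalIntegral.integral_const_mul]
  ring

lemma exists_trueError_bound {n : ℕ} (hn : 1 ≤ n) : ∃ K : ℝ, 0 < K ∧ ∀ (f : ℝ → ℝ) (δ : ℝ),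
    (∀ t ∈ Icc (0 : ℝ) ((n : ℝ) - 1), |f t| ≤ δ) → |trueError n f 0 1| ≤ K * δ := by
  have h1 : (0 : ℝ) ≤ (n : ℝ) - 1 := by
    have : (1 : ℝ) ≤ n := by exact_mod_cast hn
    linarith
  obtain ⟨K, hK0, hK⟩ := exists_correction_bound n
  refine ⟨2 * ((n : ℝ) - 1) + K + 1, by positivity, fun f δ hf => ?_⟩
  have hf0 := hf 0 ⟨le_rfl, h1⟩
  have hδ : 0 ≤ δ := (abs_nonneg _).trans hf0
  have hI : |∫ t in (0 : ℝ)..((n : ℝ) - 1), f t| ≤ δ * ((n : ℝ) - 1) := by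
    have := intervalIntegral.norm_integral_le_of_norm_le_const (a := 0) (b := (n : ℝ) - 1)
      (f := f) (C := δ) fun t ht => by
        rw [uIoc_of_le h1] at ht
        exact hf t ⟨ht.1.le, ht.2⟩
    rwa [sub_zero, abs_of_nonneg h1] at this
  have h0 : |((n : ℝ) - 1) * f 0| ≤ ((n : ℝ) - 1) * δ := by
    rw [abs_mul, abs_of_nonneg h1]
    gcongr
  rw [trueError_zero_one]
  have h2 := abs_sub ((∫ t in (0 : ℝ)..((n : ℝ) - 1), f t) - ((n : ℝ) - 1) * f 0)
    (correction n f 0 1)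
  have h3 := abs_sub (∫ t in (0 : ℝ)..((n : ℝ) - 1), f t) (((n : ℝ) - 1) * f 0)
  have h4 := hK f δ hf
  nlinarith

/-! ### Vanishing and nonvanishing of the integrals `I(w_i)`. -/

lemma newtonPoly_succ (i : ℕ) (t : ℝ) : newtonPoly 1 (i + 1) t = newtonPoly 1 i t * (t - i) := by
  simp [newtonPoly, Finset.prod_range_succ]

lemma newtonPoly_add_one (i : ℕ) (t : ℝ) :
    newtonPoly 1 (i + 1) (t + 1) = newtonPoly 1 i t * (t + 1) := by
  simp only [newtonPoly, Finset.prod_range_succ', Nat.cast_zero, zero_mul, sub_zero]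
  congr 1
  exact Finset.prod_congr rfl fun k _ => by push_cast; ring

lemma newtonPoly_reflect (i : ℕ) (s : ℝ) :
    newtonPoly 1 (i + 1) (i - s) = (-1) ^ (i + 1) * newtonPoly 1 (i + 1) s := by
  simp only [newtonPoly]
  rw [← Finset.prod_range_reflect,
    show ((-1 : ℝ)) ^ (i + 1) = ∏ _k ∈ Finset.range (i + 1), (-1 : ℝ) by simp,
    ← Finset.prod_mul_distrib]
  refine Finset.prod_congr rfl fun k hk => ?_
  have : k ≤ i := Nat.lt_succ_iff.1 (Finset.mem_range.1 hk)
  rw [show i + 1 - 1 - k = i - k by omega, Nat.cast_sub this]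
  ring

lemma newtonPoly_sign {s : ℝ} (hs : s ∈ Ioo (0 : ℝ) 1) (i : ℕ) :
    0 < (-1) ^ i * newtonPoly 1 (i + 1) s := by
  induction i with
  | zero => simpa [newtonPoly] using hs.1
  | succ i ih =>
    rw [newtonPoly_succ, pow_succ]
    have : 0 < ((i + 1 : ℕ) : ℝ) - s := by
      push_cast
      have : (0 : ℝ) ≤ i := by positivity
      linarith [hs.2]
    nlinarith [mul_pos ih this]

/-- The Newton polynomials are forward differences, so that their integrals over the panel
reduce to integrals over `[0, 1]`. -/
lemma newtonInt_eq_integral_unit (n k : ℕ) : ((k : ℝ) + 1) * newtonInt n 1 k =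
    ∫ s in (0 : ℝ)..1, (newtonPoly 1 (k + 1) (n - s) - newtonPoly 1 (k + 1) s) := by
  have hi : ∀ a b : ℝ, IntervalIntegrable (newtonPoly 1 (k + 1)) MeasureTheory.volume a b :=
    fun a b => (continuous_newtonPoly 1 (k + 1)).intervalIntegrable a b
  have hc : Continuous (newtonPoly 1 (k + 1)) := continuous_newtonPoly 1 (k + 1)
  have h1 : ((k : ℝ) + 1) * newtonInt n 1 k = ∫ t in (0 : ℝ)..((n : ℝ) - 1),
      (newtonPoly 1 (k + 1) (t + 1) - newtonPoly 1 (k + 1) t) := by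
    rw [newtonInt, mul_one, ← intervalIntegral.integral_const_mul]
    refine intervalIntegral.integral_congr fun t _ => ?_
    rw [newtonPoly_add_one, newtonPoly_succ]
    ring
  have hc1 : Continuous fun t => newtonPoly 1 (k + 1) (t + 1) := by fun_prop
  have hc2 : Continuous fun t => newtonPoly 1 (k + 1) (n - t) := by fun_prop
  rw [h1, intervalIntegral.integral_sub (hc1.intervalIntegrable _ _) (hi _ _),
    intervalIntegral.integral_sub (hc2.intervalIntegrable _ _) (hi _ _),
    intervalIntegral.integral_comp_add_right, intervalIntegral.integral_comp_sub_left]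
  simp only [zero_add, sub_add_cancel, sub_zero]
  -- The difference of the integrals over `[1, n]` and `[0, n - 1]` telescopes to the two unit
  -- intervals at the ends.
  have h2 := intervalIntegral.integral_add_adjacent_intervals (hi 0 1) (hi 1 n)
  have h3 := intervalIntegral.integral_add_adjacent_intervals (hi 0 (n - 1)) (hi (n - 1) n)
  linarith

lemma newtonInt_ne_zero_of_unit {n k : ℕ} (c : ℝ)
    (h : ∀ s ∈ Ioo (0 : ℝ) 1, 0 < c * (newtonPoly 1 (k + 1) (n - s) - newtonPoly 1 (k + 1) s)) :
    newtonInt n 1 k ≠ 0 := by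
  intro h0
  have h1 := newtonInt_eq_integral_unit n k
  have hc : Continuous (newtonPoly 1 (k + 1)) := continuous_newtonPoly 1 (k + 1)
  have h2 := intervalIntegral.intervalIntegral_pos_of_pos_on (a := 0) (b := 1)
    (Continuous.intervalIntegrable (by fun_prop) _ _) h one_pos
  rw [intervalIntegral.integral_const_mul, ← h1, h0] at h2
  simp at h2

/-- For odd `n`, `w_{n+1}` is even about `n / 2`, so the two end contributions cancel. This is the
extra degree of exactness behind `p = n + 1`. -/
lemma newtonInt_self_of_odd {n : ℕ} (hn : Odd n) : newtonInt n 1 n = 0 := by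
  have h1 := newtonInt_eq_integral_unit n n
  simp only [newtonPoly_reflect, hn.add_one.neg_one_pow, one_mul, sub_self,
    intervalIntegral.integral_zero] at h1
  have : (0 : ℝ) < n + 1 := by positivity
  exact (mul_eq_zero.1 h1).resolve_left this.ne'

lemma errOrder_of_odd {n : ℕ} (hn : Odd n) : errOrder n = n + 1 := if_pos hn

lemma errOrder_of_even {n : ℕ} (hn : Even n) : errOrder n = n :=
  if_neg (Nat.not_odd_iff_even.2 hn)

lemma le_errOrder (n : ℕ) : n ≤ errOrder n := by
  unfold errOrder
  split_ifs <;> omega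

lemma newtonInt_errOrder_ne_zero {n : ℕ} (hn : 2 ≤ n) : newtonInt n 1 (errOrder n) ≠ 0 := by
  rcases Nat.even_or_odd n with he | ho
  · rw [errOrder_of_even he]
    -- Now `w_{n+1}` is odd about `n / 2`: the integrand is `-2 * w_{n+1} s`, which is negative on
    -- `(0, 1)`.
    refine newtonInt_ne_zero_of_unit (-1) fun s hs => ?_
    have := newtonPoly_sign hs n
    rw [he.neg_one_pow] at this
    rw [newtonPoly_reflect, he.add_one.neg_one_pow]
    linarith
  · rw [errOrder_of_odd ho]
    refine newtonInt_ne_zero_of_unit (-1) fun s hs => ?_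
    have h1 := newtonPoly_sign hs n
    rw [ho.neg_one_pow] at h1
    -- Splitting off the last factor of `w_{n+2}` leaves the even `w_{n+1}`, and the integrand
    -- becomes `w_{n+1} s * (n - 2 * s)`.
    rw [newtonPoly_succ (n + 1), newtonPoly_succ (n + 1), newtonPoly_reflect, ho.add_one.neg_one_pow]
    have h2 : (2 : ℝ) ≤ n := by exact_mod_cast hn
    have h3 : 0 < (n : ℝ) - 2 * s := by linarith [hs.2]
    push_cast
    nlinarith [mul_pos h1 h3]

/-! ### Degree of exactness. -/

lemma trueError_newtonPoly_of_lt {n d : ℕ} (hn : 0 < n) (hd : d < errOrder n) :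
    trueError n (newtonPoly 1 d) 0 1 = 0 := by
  rw [trueError_newtonPoly hn]
  split_ifs with h
  · rfl
  · rcases Nat.even_or_odd n with he | ho
    · rw [errOrder_of_even he] at hd
      omega
    · rw [errOrder_of_odd ho] at hd
      rw [show d = n by omega, newtonInt_self_of_odd ho]

lemma trueError_eval_add_newton {n : ℕ} (hn : 0 < n) (P : ℝ[X]) (d : ℕ) :
    trueError n (fun t => P.eval t) 0 1 =
      trueError n (fun t => (P - C (P.coeff d) * newtonPolynomial d).eval t) 0 1 +
        P.coeff d * trueError n (newtonPoly 1 d) 0 1 := by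
  rw [← trueError_const_mul, ← trueError_add n
    (Polynomial.continuous _).continuousOn
    (g := fun t => P.coeff d * newtonPoly 1 d t)
    (continuous_const.mul (continuous_newtonPoly 1 d)).continuousOn hn]
  congr 1
  funext t
  simp [eval_newtonPolynomial]

lemma degree_sub_newton_lt {P : ℝ[X]} {d : ℕ} (hP : P.degree < (d + 1 : ℕ)) :
    (P - C (P.coeff d) * newtonPolynomial d).degree < d := by
  rw [degree_lt_iff_coeff_zero] at hP ⊢
  intro m hm
  rw [coeff_sub, coeff_C_mul]
  rcases hm.eq_or_lt with rfl | hm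
  · rw [coeff_newtonPolynomial_self]
    ring
  · rw [hP m hm, coeff_eq_zero_of_natDegree_lt (p := newtonPolynomial d)
      (by rwa [natDegree_newtonPolynomial])]
    ring

lemma trueError_eval_of_degree_lt {n : ℕ} (hn : 0 < n) {d : ℕ} (hd : d ≤ errOrder n) :
    ∀ {P : ℝ[X]}, P.degree < d → trueError n (fun t => P.eval t) 0 1 = 0 := by
  induction d with
  | zero =>
    intro P hP
    have : P = 0 := by simpa [degree_lt_iff_coeff_zero, Polynomial.ext_iff] using hP
    have h := trueError_const_mul n 0 (fun _ => 0)
    simp only [zero_mul] at h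
    simpa [this] using h
  | succ d ih =>
    intro P hP
    rw [trueError_eval_add_newton hn P d, ih (by omega) (degree_sub_newton_lt hP),
      trueError_newtonPoly_of_lt hn (by omega)]
    ring

/-- The degree of exactness of the rule and its error on the first polynomials it misses. -/
lemma trueError_eval {n : ℕ} (hn : 0 < n) {P : ℝ[X]} (hP : P.natDegree ≤ errOrder n) :
    trueError n (fun t => P.eval t) 0 1 =
      P.coeff (errOrder n) * newtonInt n 1 (errOrder n) := by
  have hd : P.degree < (errOrder n + 1 : ℕ) :=
    lt_of_le_of_lt degree_le_natDegree (by exact_mod_cast Nat.lt_succ_of_le hP)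
  rw [trueError_eval_add_newton hn P (errOrder n),
    trueError_eval_of_degree_lt hn le_rfl (degree_sub_newton_lt hd), trueError_newtonPoly hn,
    if_neg (not_lt.2 (le_errOrder n)), zero_add]

lemma correction_const (n : ℕ) (c : ℝ) : correction n (fun _ => c) 0 1 = 0 := by
  have h := correction_newtonPoly n 0
  have h' := correction_const_mul n c (newtonPoly 1 0) 0 1
  simpa [newtonPoly, h] using h'

/-- The rule is exact on `t ^ q` and `t ^ q` vanishes at the first node, so the correction is the
whole integral. -/
lemma correction_pow {n q : ℕ} (hn : 0 < n) (hq : 1 ≤ q) (hq' : q < errOrder n) :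
    correction n (fun t => t ^ q) 0 1 = ((n : ℝ) - 1) ^ (q + 1) / (q + 1) := by
  have h1 := trueError_eval_of_degree_lt hn le_rfl (P := X ^ q)
    (by rw [degree_X_pow]; exact_mod_cast hq')
  simp only [eval_pow, eval_X] at h1
  rw [trueError_zero_one, integral_pow] at h1
  rw [zero_pow (by omega), zero_pow (by omega), sub_zero] at h1
  linarith

lemma newtonInt_one (n : ℕ) : newtonInt n 1 1 = ((n : ℝ) - 1) ^ 2 / 2 := by
  simp [newtonInt, newtonPoly, integral_id]

/-! ### Taylor polynomials and leading terms as the step tends to zero. -/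

/-- The Taylor polynomial of degree `d` of `f` at `x` within `s`, in powers of the increment. -/
def taylorPoly (f : ℝ → ℝ) (s : Set ℝ) (x : ℝ) (d : ℕ) : ℝ[X] :=
  ∑ j ∈ Finset.range (d + 1), C (iteratedDerivWithin j f s x / (j.factorial : ℝ)) * X ^ j

lemma eval_taylorPoly (f : ℝ → ℝ) (s : Set ℝ) (x : ℝ) (d : ℕ) (t : ℝ) :
    (taylorPoly f s x d).eval t = taylorWithinEval f d s x (x + t) := by
  rw [taylor_within_apply, taylorPoly, eval_finsetSum]
  refine Finset.sum_congr rfl fun j _ => ?_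
  simp only [eval_mul, eval_C, eval_pow, eval_X, smul_eq_mul, add_sub_cancel_left]
  ring

lemma coeff_taylorPoly (f : ℝ → ℝ) (s : Set ℝ) (x : ℝ) (d j : ℕ) :
    (taylorPoly f s x d).coeff j =
      if j ≤ d then iteratedDerivWithin j f s x / (j.factorial : ℝ) else 0 := by
  simp only [taylorPoly, finsetSum_coeff, coeff_C_mul, coeff_X_pow, mul_ite, mul_one, mul_zero]
  rw [Finset.sum_ite_eq]
  simp

lemma natDegree_taylorPoly_le (f : ℝ → ℝ) (s : Set ℝ) (x : ℝ) (d : ℕ) :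
    (taylorPoly f s x d).natDegree ≤ d :=
  natDegree_le_iff_coeff_eq_zero.2 fun j hj => by
    rw [coeff_taylorPoly, if_neg (by omega)]

lemma eval_comp_C_mul_X (P : ℝ[X]) (h : ℝ) :
    (fun t => P.eval (h * t)) = fun t => (P.comp (C h * X)).eval t := by
  simp

lemma natDegree_comp_C_mul_X_le (P : ℝ[X]) (h : ℝ) {d : ℕ} (hP : P.natDegree ≤ d) :
    (P.comp (C h * X)).natDegree ≤ d :=
  natDegree_le_iff_coeff_eq_zero.2 fun j hj => by
    rw [comp_C_mul_X_coeff, coeff_eq_zero_of_natDegree_lt (by omega), zero_mul]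

section Asymptotics

variable {a b x m : ℝ} {f : ℝ → ℝ} {q : ℕ}

lemma eventually_mapsTo_panel (hax : a ≤ x) (hxb : x < b) (hm : 0 ≤ m) :
    ∀ᶠ h in 𝓝[>] (0 : ℝ), ∀ t ∈ Icc (0 : ℝ) m, x + h * t ∈ Icc a b := by
  have hpos : 0 < (b - x) / (m + 1) := div_pos (by linarith) (by linarith)
  filter_upwards [Ioo_mem_nhdsGT hpos] with h hh t ht
  have h1 : h * (m + 1) < b - x := (lt_div_iff₀ (by linarith)).1 hh.2
  have h2 : 0 ≤ h * t := mul_nonneg hh.1.le ht.1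
  have h3 : h * t ≤ h * m := mul_le_mul_of_nonneg_left ht.2 hh.1.le
  have h4 := hh.1
  constructor <;> nlinarith

lemma taylorPoly_uniform (hf : ContDiffOn ℝ q f (Icc a b)) (hax : a ≤ x) (hxb : x < b)
    (hm : 0 ≤ m) {η : ℝ} (hη : 0 < η) :
    ∀ᶠ h in 𝓝[>] (0 : ℝ), ∀ t ∈ Icc (0 : ℝ) m,
      |f (x + h * t) - (taylorPoly f (Icc a b) x q).eval (h * t)| ≤ η * h ^ q := by
  have hmq : 0 ≤ m ^ q := pow_nonneg hm q
  have ho := taylor_isLittleO (convex_Icc a b) (x₀ := x) ⟨hax, hxb.le⟩ hf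
  have he := (Asymptotics.isLittleO_iff.1 ho) (show 0 < η / (m ^ q + 1) by positivity)
  obtain ⟨ε, hε, hball⟩ := Metric.mem_nhdsWithin_iff.1 he
  have hpos : 0 < ε / (m + 1) := div_pos hε (by linarith)
  filter_upwards [Ioo_mem_nhdsGT hpos, eventually_mapsTo_panel hax hxb hm] with h hh hmaps t ht
  have h1 : h * (m + 1) < ε := (lt_div_iff₀ (by linarith)).1 hh.2
  have h2 : 0 ≤ h * t := mul_nonneg hh.1.le ht.1
  have h3 : h * t ≤ h * m := mul_le_mul_of_nonneg_left ht.2 hh.1.le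
  have h4 : (0 : ℝ) < h := hh.1
  have hb := hball ⟨by
    rw [Metric.mem_ball, Real.dist_eq, add_sub_cancel_left, abs_of_nonneg h2]; nlinarith,
    hmaps t ht⟩
  simp only [mem_ofPred_eq, Real.norm_eq_abs, add_sub_cancel_left] at hb
  rw [eval_taylorPoly]
  refine hb.trans ?_
  rw [abs_of_nonneg (pow_nonneg h2 q), mul_pow]
  have h5 : t ^ q ≤ m ^ q := pow_le_pow_left₀ ht.1 ht.2 q
  have h6 : 0 < h ^ q := pow_pos h4 q
  rw [div_mul_eq_mul_div, div_le_iff₀ (by positivity)]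
  have : h ^ q * t ^ q ≤ h ^ q * (m ^ q + 1) := by gcongr; linarith
  nlinarith

/-- A functional controlled by the supremum norm on `[0, m]` sees only the leading behaviour of
the Taylor polynomial. -/
lemma tendsto_functional_div_pow (hf : ContDiffOn ℝ q f (Icc a b)) (hax : a ≤ x) (hxb : x < b)
    (hm : 0 ≤ m) {Λ : (ℝ → ℝ) → ℝ} {K c : ℝ}
    (hadd : ∀ F G : ℝ → ℝ, ContinuousOn F (Icc 0 m) → ContinuousOn G (Icc 0 m) →
      Λ (fun t => F t + G t) = Λ F + Λ G)
    (hK : ∀ (F : ℝ → ℝ) (δ : ℝ), (∀ t ∈ Icc (0 : ℝ) m, |F t| ≤ δ) → |Λ F| ≤ K * δ)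
    (hT : ∀ h : ℝ, Λ (fun t => (taylorPoly f (Icc a b) x q).eval (h * t)) = c * h ^ q) :
    Tendsto (fun h => Λ (fun t => f (x + h * t)) / h ^ q) (𝓝[>] 0) (𝓝 c) := by
  rw [Metric.tendsto_nhds]
  intro ε hε
  have hη : 0 < ε / (|K| + 1) := by positivity
  filter_upwards [taylorPoly_uniform hf hax hxb hm hη, eventually_mapsTo_panel hax hxb hm,
    self_mem_nhdsWithin] with h hu hmaps hpos
  have hpos : 0 < h := hpos
  have hc : ContinuousOn (fun t => f (x + h * t)) (Icc 0 m) :=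
    hf.continuousOn.comp (by fun_prop) hmaps
  have hcT : Continuous fun t => (taylorPoly f (Icc a b) x q).eval (h * t) :=
    (Polynomial.continuous _).comp (continuous_const.mul continuous_id)
  -- Split into Peano remainder and Taylor polynomial: the latter contributes exactly `c * h ^ q`,
  -- the former less than `ε * h ^ q`.
  have h1 := hadd (fun t => f (x + h * t) - (taylorPoly f (Icc a b) x q).eval (h * t)) _
    (hc.sub hcT.continuousOn) hcT.continuousOn
  simp only [sub_add_cancel] at h1
  have h2 := hK _ _ hu
  have h3 : 0 < h ^ q := pow_pos hpos q
  rw [Real.dist_eq, h1, hT, add_div, mul_div_assoc, div_self h3.ne', mul_one, add_sub_cancel_right,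
    abs_div, abs_of_pos h3, div_lt_iff₀ h3]
  refine h2.trans_lt ?_
  have h4 : K * (ε / (|K| + 1)) < ε := by
    rw [mul_div_assoc', div_lt_iff₀ (by positivity)]
    nlinarith [le_abs_self K]
  rw [← mul_assoc]
  exact mul_lt_mul_of_pos_right h4 h3

lemma tendsto_divDiff_div_pow (hf : ContDiffOn ℝ q f (Icc a b)) (hax : a ≤ x) (hxb : x < b)
    (hm : 0 ≤ m) {v : ℕ → ℝ} (hv : InjOn v (Finset.range (q + 1)))
    (hvm : ∀ i ≤ q, v i ∈ Icc 0 m) :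
    Tendsto (fun h => divDiff (fun t => f (x + h * t)) v q / h ^ q) (𝓝[>] 0)
      (𝓝 (iteratedDerivWithin q f (Icc a b) x / (q.factorial : ℝ))) := by
  obtain ⟨K, -, hK⟩ := exists_divDiff_bound v q
  refine tendsto_functional_div_pow hf hax hxb hm (Λ := fun F => divDiff F v q) (K := K)
    (fun F G _ _ => divDiff_add F G v q)
    (fun F δ hF => hK F δ fun i hi => hF _ (hvm i hi)) fun h => ?_
  rw [eval_comp_C_mul_X, divDiff_eval hv
    (natDegree_comp_C_mul_X_le _ _ (natDegree_taylorPoly_le _ _ _ _)), comp_C_mul_X_coeff,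
    coeff_taylorPoly, if_pos le_rfl]

lemma sub_one_nonneg_of_le {n : ℕ} (hn : 1 ≤ n) : (0 : ℝ) ≤ (n : ℝ) - 1 := by
  have : (1 : ℝ) ≤ n := by exact_mod_cast hn
  linarith

lemma tendsto_trueError_div_pow {n : ℕ} (hn : 1 ≤ n)
    (hf : ContDiffOn ℝ (errOrder n : ℕ) f (Icc a b)) (hax : a ≤ x) (hxb : x < b) :
    Tendsto (fun h => trueError n (fun t => f (x + h * t)) 0 1 / h ^ errOrder n) (𝓝[>] 0)
      (𝓝 (iteratedDerivWithin (errOrder n) f (Icc a b) x / ((errOrder n).factorial : ℝ) *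
        newtonInt n 1 (errOrder n))) := by
  obtain ⟨K, -, hK⟩ := exists_trueError_bound hn
  refine tendsto_functional_div_pow hf hax hxb (sub_one_nonneg_of_le hn)
    (Λ := fun F => trueError n F 0 1) (K := K) (fun F G hF hG => trueError_add n hF hG hn) hK
    fun h => ?_
  rw [eval_comp_C_mul_X, trueError_eval hn
    (natDegree_comp_C_mul_X_le _ _ (natDegree_taylorPoly_le _ _ _ _)), comp_C_mul_X_coeff,
    coeff_taylorPoly, if_pos le_rfl]
  ring

lemma tendsto_correction_div_pow {n : ℕ} (hn : 1 ≤ n) (hq : 1 ≤ q) (hqp : q < errOrder n)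
    (hf : ContDiffOn ℝ q f (Icc a b)) (hax : a ≤ x) (hxb : x < b)
    (h0 : ∀ j, 1 ≤ j → j < q → iteratedDerivWithin j f (Icc a b) x = 0) :
    Tendsto (fun h => correction n (fun t => f (x + h * t)) 0 1 / h ^ q) (𝓝[>] 0)
      (𝓝 (iteratedDerivWithin q f (Icc a b) x / (q.factorial : ℝ) *
        (((n : ℝ) - 1) ^ (q + 1) / (q + 1)))) := by
  obtain ⟨K, -, hK⟩ := exists_correction_bound n
  refine tendsto_functional_div_pow hf hax hxb (sub_one_nonneg_of_le hn)
    (Λ := fun F => correction n F 0 1) (K := K) (fun F G _ _ => correction_add n F G 0 1) hK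
    fun h => ?_
  have hT : (fun t => (taylorPoly f (Icc a b) x q).eval (h * t)) = fun t => f x +
      (iteratedDerivWithin q f (Icc a b) x / (q.factorial : ℝ) * h ^ q) * t ^ q := by
    funext t
    obtain ⟨r, rfl⟩ : ∃ r, q = r + 1 := ⟨q - 1, by omega⟩
    rw [taylorPoly, eval_finsetSum, Finset.sum_range_succ, Finset.sum_range_succ',
      Finset.sum_eq_zero]
    · simp
      ring
    · intro j hj
      rw [h0 (j + 1) (by omega) (by have := Finset.mem_range.1 hj; omega)]
      simp
  rw [hT, correction_add, correction_const, correction_const_mul, correction_pow hn hq hqp]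
  ring

lemma extNode_mem {n : ℕ} (hn : 2 ≤ n) (i : ℕ) :
    extNode n 0 1 i ∈ Icc (0 : ℝ) ((n : ℝ) - 1) := by
  have h2 : (2 : ℝ) ≤ n := by exact_mod_cast hn
  unfold extNode
  split_ifs with h1 h3
  · exact node_zero_one_mem h1
  · simp only [node_zero_one]
    constructor <;> norm_num; linarith
  · simp only [node_zero_one]
    rw [Nat.cast_sub hn, Nat.cast_sub (by omega : 1 ≤ n)]
    push_cast
    constructor <;> linarith

lemma injOn_extNode {n : ℕ} (hn : 2 ≤ n) :
    InjOn (extNode n 0 1) (Finset.range (errOrder n + 1)) := by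
  have hodd : n + 1 ≤ errOrder n → 3 ≤ n := by
    unfold errOrder
    split_ifs with h
    · rintro -
      obtain ⟨k, rfl⟩ := h
      omega
    · omega
  have hle : errOrder n ≤ n + 1 := by
    unfold errOrder
    split_ifs <;> omega
  -- Doubled, panel nodes are even integers and midpoints odd ones. The midpoints coincide only for
  -- `n = 2`, but the second is used only for odd `n`, hence `n ≥ 3`.
  have hval : ∀ i, 2 * extNode n 0 1 i =
      ((if i < n then 2 * i else if i = n then 1 else 2 * n - 3 : ℕ) : ℝ) := by
    intro i
    unfold extNode
    simp only [node_zero_one]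
    split_ifs
    · push_cast; ring
    · push_cast; ring
    · rw [Nat.cast_sub hn, Nat.cast_sub (by omega : 1 ≤ n), Nat.cast_sub (by omega)]
      push_cast
      ring
  intro i hi j hj hij
  have hi' := Finset.mem_range.1 hi
  have hj' := Finset.mem_range.1 hj
  have h1 := hval i
  rw [hij, hval j] at h1
  have h2 := Nat.cast_injective h1
  split_ifs at h2 <;> omega

/-- The correction behaves like `f' x * m ^ 2 / 2 * h` with `m = n - 1`. Since `I(w_1) = m ^ 2 / 2`,
this cancels both denominators of the estimate and leaves the limit found for the true error. -/
lemma tendsto_errorEstimate_div_pow {n : ℕ} (hn : 2 ≤ n)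
    (hf : ContDiffOn ℝ (errOrder n : ℕ) f (Icc a b)) (hax : a ≤ x) (hxb : x < b)
    (h1 : iteratedDerivWithin 1 f (Icc a b) x ≠ 0) :
    Tendsto (fun h => errorEstimate n (fun t => f (x + h * t)) 0 1 / h ^ errOrder n) (𝓝[>] 0)
      (𝓝 (iteratedDerivWithin (errOrder n) f (Icc a b) x / ((errOrder n).factorial : ℝ) *
        newtonInt n 1 (errOrder n))) := by
  have hp := le_errOrder n
  have hm := sub_one_nonneg_of_le (n := n) (by omega)
  have h2 : (2 : ℝ) ≤ n := by exact_mod_cast hn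
  have hm0 : (n : ℝ) - 1 ≠ 0 := by linarith
  have hf1 : ContDiffOn ℝ (1 : ℕ) f (Icc a b) := hf.of_le (by exact_mod_cast (by omega))
  have t1 := tendsto_divDiff_div_pow hf hax hxb hm (injOn_extNode hn) fun i _ => extNode_mem hn i
  have t2 := tendsto_divDiff_div_pow hf1 hax hxb hm (injOn_node_zero_one _)
    fun i hi => node_zero_one_mem (by omega)
  have t3 := tendsto_correction_div_pow (by omega) le_rfl (by omega) hf1 hax hxb
    (n := n) fun j hj hj' => absurd hj' (by omega)
  have t := (((t1.div t2 (by simpa using h1)).const_mul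
    (newtonInt n 1 (errOrder n) / newtonInt n 1 1)).mul t3)
  refine (t.congr' ?_).trans (le_of_eq ?_)
  · filter_upwards [self_mem_nhdsWithin] with h hpos
    have hpos : h ≠ 0 := ne_of_gt hpos
    simp only [errorEstimate, Pi.div_apply]
    field_simp
  · congr 1
    rw [newtonInt_one]
    simp only [Nat.factorial_one, Nat.cast_one, div_one]
    field_simp
    ring

end Asymptotics

/-! ### From leading terms to inequalities for small steps. -/

lemma exists_forall_of_eventually_nhdsGT {p : ℝ → Prop} (hp : ∀ᶠ h in 𝓝[>] (0 : ℝ), p h) :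
    ∃ h₀ : ℝ, 0 < h₀ ∧ ∀ h, 0 < h → h < h₀ → p h := by
  obtain ⟨u, hu, hsub⟩ := mem_nhdsGT_iff_exists_Ioo_subset.1 hp
  exact ⟨u, hu, fun h h1 h2 => hsub ⟨h1, h2⟩⟩

lemma eventually_abs_le_of_tendsto_div_pow {E G : ℝ → ℝ} {p q : ℕ} {e c : ℝ} (hqp : q < p)
    (hE : Tendsto (fun h => E h / h ^ p) (𝓝[>] 0) (𝓝 e))
    (hG : Tendsto (fun h => G h / h ^ q) (𝓝[>] 0) (𝓝 c)) (hc : c ≠ 0) {η : ℝ} (hη : 0 < η) :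
    ∀ᶠ h in 𝓝[>] (0 : ℝ), G h ≠ 0 ∧ |E h| ≤ η * |G h| := by
  have hpow : Tendsto (fun h : ℝ => h ^ (p - q)) (𝓝[>] 0) (𝓝 0) := by
    have : Tendsto (fun h : ℝ => h ^ (p - q)) (𝓝 0) (𝓝 (0 ^ (p - q))) :=
      (continuous_pow (p - q)).tendsto 0
    rw [zero_pow (by omega)] at this
    exact this.mono_left nhdsWithin_le_nhds
  have ht := (hE.mul hpow).div hG hc
  rw [mul_zero, zero_div] at ht
  filter_upwards [self_mem_nhdsWithin, Metric.tendsto_nhds.1 ht η hη, hG.eventually_ne hc]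
    with h hpos hlt hne
  have hpos : 0 < h := hpos
  have hG0 : G h ≠ 0 := fun h0 => hne (by rw [h0, zero_div])
  refine ⟨hG0, ?_⟩
  have heq : E h / h ^ p * h ^ (p - q) / (G h / h ^ q) = E h / G h := by
    have : h ^ p = h ^ (p - q) * h ^ q := by rw [← pow_add]; congr 1; omega
    rw [this]
    field_simp
  simp only [Pi.div_apply] at hlt
  rw [heq, dist_zero_right, Real.norm_eq_abs, abs_div, div_lt_iff₀ (abs_pos.2 hG0)] at hlt
  exact hlt.le

lemma eventually_abs_sub_le_mul_pow {E G : ℝ → ℝ} {p : ℕ} {e : ℝ}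
    (hE : Tendsto (fun h => E h / h ^ p) (𝓝[>] 0) (𝓝 e))
    (hG : Tendsto (fun h => G h / h ^ p) (𝓝[>] 0) (𝓝 e)) {η : ℝ} (hη : 0 < η) :
    ∀ᶠ h in 𝓝[>] (0 : ℝ), |E h - G h| ≤ η * h ^ p := by
  have ht := hE.sub hG
  rw [sub_self] at ht
  filter_upwards [self_mem_nhdsWithin, Metric.tendsto_nhds.1 ht η hη] with h hpos hlt
  have hp : 0 < h ^ p := pow_pos hpos p
  rw [← sub_div, dist_zero_right, Real.norm_eq_abs, abs_div, abs_of_pos hp, div_lt_iff₀ hp] at hlt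
  exact hlt.le

lemma eventually_abs_sub_le_mul_abs {E G : ℝ → ℝ} {p : ℕ} {e : ℝ}
    (hE : Tendsto (fun h => E h / h ^ p) (𝓝[>] 0) (𝓝 e))
    (hG : Tendsto (fun h => G h / h ^ p) (𝓝[>] 0) (𝓝 e)) (he : e ≠ 0) {η : ℝ} (hη : 0 < η) :
    ∀ᶠ h in 𝓝[>] (0 : ℝ), E h ≠ 0 ∧ |E h - G h| ≤ η * |E h| := by
  have he' : 0 < |e| / 2 := half_pos (abs_pos.2 he)
  filter_upwards [self_mem_nhdsWithin, eventually_abs_sub_le_mul_pow hE hG (mul_pos hη he'),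
    hE.abs.eventually_const_lt (half_lt_self (abs_pos.2 he))] with h hpos hle hlt
  have hp : 0 < h ^ p := pow_pos hpos p
  rw [abs_div, abs_of_pos hp, lt_div_iff₀ hp] at hlt
  refine ⟨abs_pos.1 ((mul_pos he' hp).trans hlt), hle.trans ?_⟩
  rw [mul_assoc]
  gcongr

/-- As `|E|` is below ten units of its leading decimal place, the scaled absolute values differ by
less than one, so their floors differ by at most one. Any factor up to `1 / 10` would do. -/
lemma isRealisticEstimate_of_abs_sub_le {E G : ℝ} (hE : E ≠ 0) (h : |E - G| ≤ 1 / 20 * |E|) :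
    IsRealisticEstimate E G := by
  have hpos := abs_pos.2 hE
  refine ⟨hE, ?_, ?_⟩
  · rcases lt_or_gt_of_ne hE with h0 | h0
    · rw [abs_of_neg h0, abs_le] at h
      rw [sign_neg h0, sign_neg (by linarith)]
    · rw [abs_of_pos h0, abs_le] at h
      rw [sign_pos h0, sign_pos (by linarith)]
  · have hz : (0 : ℝ) < 10 ^ Int.log 10 |E| := by positivity
    have h10 : |E| < 10 ^ Int.log 10 |E| * 10 := by
      have := Int.lt_zpow_succ_log_self (b := 10) (by norm_num) |E|
      rwa [Nat.cast_ofNat, zpow_add_one₀ (by norm_num)] at this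
    have hd : |(|G| / (10 : ℝ) ^ Int.log 10 |E|) - (|E| / 10 ^ Int.log 10 |E|)| < 1 := by
      rw [← sub_div, abs_div, abs_of_pos hz, div_lt_one hz]
      have h1 := abs_abs_sub_abs_le G E
      rw [abs_sub_comm G E] at h1
      linarith
    generalize |G| / (10 : ℝ) ^ Int.log 10 |E| = u at hd
    generalize |E| / (10 : ℝ) ^ Int.log 10 |E| = w at hd
    rw [abs_lt] at hd
    have a1 := Int.floor_le u
    have a2 := Int.lt_floor_add_one u
    have a3 := Int.floor_le w
    have a4 := Int.lt_floor_add_one w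
    have b1 : ((⌊u⌋ : ℤ) : ℝ) < ((⌊w⌋ + 2 : ℤ) : ℝ) := by push_cast; linarith
    have b2 : ((⌊w⌋ : ℤ) : ℝ) < ((⌊u⌋ + 2 : ℤ) : ℝ) := by push_cast; linarith
    rw [Int.cast_lt] at b1 b2
    rw [abs_le]
    constructor <;> omega

/-- If some derivative of order below that of the error term does not vanish at the first node,
the error of the corrected rule is small compared with the correction. -/
lemma exists_trueError_le_correction {n : ℕ} (hn : 2 ≤ n) {a b x : ℝ} {f : ℝ → ℝ}
    (hf : ContDiffOn ℝ (errOrder n : ℕ) f (Icc a b)) (hax : a ≤ x) (hxb : x < b)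
    (hj : ∃ j : ℕ, 1 ≤ j ∧ j < errOrder n ∧ iteratedDerivWithin j f (Icc a b) x ≠ 0)
    {η : ℝ} (hη : 0 < η) : ∃ h₀ : ℝ, 0 < h₀ ∧ ∀ h : ℝ, 0 < h → h < h₀ →
      correction n f x h ≠ 0 ∧ |trueError n f x h| ≤ η * |correction n f x h| := by
  classical
  -- The least such `j` makes the correction of exact order `h ^ j` in the unit-step scale, against
  -- an error of order `h ^ p` with `j < p`.
  obtain ⟨hj1, hjp, hj0⟩ := Nat.find_spec hj
  set j := Nat.find hj with hjdef
  have hmin : ∀ i, 1 ≤ i → i < j → iteratedDerivWithin i f (Icc a b) x = 0 := by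
    intro i h1 h2
    by_contra h3
    exact Nat.find_min hj h2 ⟨h1, h2.trans hjp, h3⟩
  have h2 : (2 : ℝ) ≤ n := by exact_mod_cast hn
  have hm0 : 0 < (n : ℝ) - 1 := by linarith
  have ht := tendsto_correction_div_pow (n := n) (by omega) hj1 hjp
    (hf.of_le (by exact_mod_cast hjp.le)) hax hxb hmin
  obtain ⟨h₀, hh₀, hmain⟩ := exists_forall_of_eventually_nhdsGT
    (eventually_abs_le_of_tendsto_div_pow hjp
      (tendsto_trueError_div_pow (n := n) (by omega) hf hax hxb) ht
      (mul_ne_zero (div_ne_zero hj0 (by positivity)) (by positivity)) hη)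
  refine ⟨h₀, hh₀, fun h hpos hlt => ?_⟩
  obtain ⟨h3, h4⟩ := hmain h hpos hlt
  rw [trueError_scale n f x hpos.ne', correction_scale n f x hpos.ne', abs_mul, abs_mul]
  refine ⟨mul_ne_zero hpos.ne' h3, ?_⟩
  rw [mul_left_comm]
  gcongr

lemma exists_trueError_sub_errorEstimate_le {n : ℕ} (hn : 2 ≤ n) {a b x : ℝ} {f : ℝ → ℝ}
    (hf : ContDiffOn ℝ (errOrder n : ℕ) f (Icc a b)) (hax : a ≤ x) (hxb : x < b)
    (h1 : iteratedDerivWithin 1 f (Icc a b) x ≠ 0) {η : ℝ} (hη : 0 < η) :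
    ∃ h₀ : ℝ, 0 < h₀ ∧ ∀ h : ℝ, 0 < h → h < h₀ →
      |trueError n f x h - errorEstimate n f x h| ≤ η * h ^ (errOrder n + 1) ∧
      (iteratedDerivWithin (errOrder n) f (Icc a b) x ≠ 0 →
        |trueError n f x h - errorEstimate n f x h| ≤ η * |trueError n f x h| ∧
        IsRealisticEstimate (trueError n f x h) (errorEstimate n f x h)) := by
  have hE := tendsto_trueError_div_pow (n := n) (by omega) hf hax hxb
  have hG := tendsto_errorEstimate_div_pow hn hf hax hxb h1
  -- The nonvanishing condition stays inside the event so that one `h₀` serves both conclusions; `1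
  -- / 20` is the tolerance for the leading digit.
  have hev : ∀ᶠ h in 𝓝[>] (0 : ℝ), iteratedDerivWithin (errOrder n) f (Icc a b) x ≠ 0 →
      trueError n (fun t => f (x + h * t)) 0 1 ≠ 0 ∧
      |trueError n (fun t => f (x + h * t)) 0 1 - errorEstimate n (fun t => f (x + h * t)) 0 1| ≤
        min η (1 / 20) * |trueError n (fun t => f (x + h * t)) 0 1| := by
    by_cases h0 : iteratedDerivWithin (errOrder n) f (Icc a b) x = 0
    · exact Eventually.of_forall fun h hne => absurd h0 hne
    · filter_upwards [eventually_abs_sub_le_mul_abs hE hG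
        (mul_ne_zero (div_ne_zero h0 (by positivity)) (newtonInt_errOrder_ne_zero hn))
        (lt_min hη (by norm_num : (0 : ℝ) < 1 / 20))] with h hh _ using hh
  obtain ⟨h₀, hh₀, hmain⟩ := exists_forall_of_eventually_nhdsGT
    ((eventually_abs_sub_le_mul_pow hE hG hη).and hev)
  refine ⟨h₀, hh₀, fun h hpos hlt => ?_⟩
  obtain ⟨h3, h4⟩ := hmain h hpos hlt
  rw [trueError_scale n f x hpos.ne', errorEstimate_scale n f x hpos.ne']
  refine ⟨?_, fun h0 => ?_⟩
  · rw [← mul_sub, abs_mul, abs_of_pos hpos, pow_succ']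
    calc _ ≤ h * (η * h ^ errOrder n) := by gcongr
      _ = _ := by ring
  · obtain ⟨h5, h6⟩ := h4 h0
    have hle : ∀ c, min η (1 / 20) ≤ c → |h * trueError n (fun t => f (x + h * t)) 0 1 -
        h * errorEstimate n (fun t => f (x + h * t)) 0 1| ≤
          c * |h * trueError n (fun t => f (x + h * t)) 0 1| := by
      intro c hc
      rw [← mul_sub, abs_mul, abs_mul, mul_left_comm]
      exact mul_le_mul_of_nonneg_left (h6.trans (by gcongr)) (abs_nonneg _)
    exact ⟨hle η (min_le_left _ _), isRealisticEstimate_of_abs_sub_le (mul_ne_zero hpos.ne' h5)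
      (hle _ (min_le_right _ _))⟩

/-! ### The uniform error bound. -/

/-- A polynomial of bounded degree which is small on `[0, m / 2]` has a small derivative on
`[0, m]`. -/
lemma exists_derivative_bound {m : ℝ} (hm : 0 < m) (d : ℕ) : ∃ Λ : ℝ, 0 < Λ ∧
    ∀ (P : ℝ[X]) (δ : ℝ), P.degree < d → (∀ s ∈ Icc (0 : ℝ) (m / 2), |P.eval s| ≤ δ) →
      ∀ t ∈ Icc (0 : ℝ) m, |P.derivative.eval t| ≤ Λ * δ := by
  -- Interpolation at `d` points of `[0, m / 2]` recovers `P`; its derivative is then bounded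
  -- through the derivatives of the Lagrange basis on the compact `[0, m]`.
  let v : ℕ → ℝ := fun i => m / 2 * (i / (d + 1))
  have hv : InjOn v (Finset.range d) := by
    intro i _ j _ hij
    have hd : ((d : ℝ) + 1) ≠ 0 := by positivity
    have h1 : (i : ℝ) / (d + 1) = j / (d + 1) := mul_left_cancel₀ (half_pos hm).ne' hij
    rw [div_left_inj' hd] at h1
    exact_mod_cast h1
  have hvm : ∀ i ∈ Finset.range d, v i ∈ Icc (0 : ℝ) (m / 2) := by
    intro i hi
    refine ⟨by positivity, mul_le_of_le_one_right (half_pos hm).le ?_⟩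
    rw [div_le_one (by positivity)]
    have : (i : ℝ) < d := by exact_mod_cast Finset.mem_range.1 hi
    linarith
  have hb : ∀ i, ∃ B : ℝ, ∀ t ∈ Icc (0 : ℝ) m,
      ‖(Lagrange.basis (Finset.range d) v i).derivative.eval t‖ ≤ B := fun i =>
    isCompact_Icc.exists_bound_of_continuousOn (Polynomial.continuous _).continuousOn
  choose B hB using hb
  have hB0 : ∀ i, 0 ≤ B i := fun i => (norm_nonneg _).trans (hB i 0 ⟨le_rfl, hm.le⟩)
  refine ⟨∑ i ∈ Finset.range d, B i + 1,
    by have := Finset.sum_nonneg fun i (_ : i ∈ Finset.range d) => hB0 i; linarith,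
    fun P δ hP hδ t ht => ?_⟩
  have hδ0 : 0 ≤ δ := (abs_nonneg _).trans (hδ 0 ⟨le_rfl, (half_pos hm).le⟩)
  have heq := Lagrange.eq_interpolate (f := P) hv (by simpa using hP)
  rw [Lagrange.interpolate_apply] at heq
  have hder : P.derivative.eval t = ∑ i ∈ Finset.range d,
      P.eval (v i) * (Lagrange.basis (Finset.range d) v i).derivative.eval t := by
    conv_lhs => rw [heq]
    simp [eval_finsetSum]
  rw [hder, add_mul, Finset.sum_mul]
  have : |∑ i ∈ Finset.range d,
      P.eval (v i) * (Lagrange.basis (Finset.range d) v i).derivative.eval t| ≤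
        ∑ i ∈ Finset.range d, B i * δ := by
    refine (Finset.abs_sum_le_sum_abs _ _).trans (Finset.sum_le_sum fun i hi => ?_)
    rw [abs_mul, mul_comm]
    exact mul_le_mul (hB i t ht) (hδ _ (hvm i hi)) (abs_nonneg _) (hB0 i)
  linarith

/-- `F ≥ F 0` on `[0, s]` and `F ≥ F s` on `[s, m]`, an interval of length at least `m / 2`. -/
lemma MonotoneOn.half_mul_sub_le_integral {F : ℝ → ℝ} {m : ℝ} (hF : MonotoneOn F (Icc 0 m))
    {s : ℝ} (hs : s ∈ Icc 0 (m / 2)) :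
    m / 2 * |F s - F 0| ≤ |(∫ t in (0 : ℝ)..m, F t) - m * F 0| := by
  have hm : 0 ≤ m := by linarith [hs.1, hs.2]
  have hsm : s ≤ m := by linarith [hs.2]
  have hs' : s ∈ Icc 0 m := ⟨hs.1, hsm⟩
  have h0 : (0 : ℝ) ∈ Icc 0 m := ⟨le_rfl, hm⟩
  have i1 : IntervalIntegrable F MeasureTheory.volume 0 s :=
    MonotoneOn.intervalIntegrable
      (hF.mono (by rw [uIcc_of_le hs.1]; exact Icc_subset_Icc_right hsm))
  have i2 : IntervalIntegrable F MeasureTheory.volume s m :=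
    MonotoneOn.intervalIntegrable
      (hF.mono (by rw [uIcc_of_le hsm]; exact Icc_subset_Icc_left hs.1))
  have e1 := intervalIntegral.integral_mono_on hs.1 intervalIntegrable_const i1
    fun t ht => hF h0 ⟨ht.1, ht.2.trans hsm⟩ ht.1
  have e2 := intervalIntegral.integral_mono_on hsm intervalIntegrable_const i2
    fun t ht => hF hs' ⟨hs.1.trans ht.1, ht.2⟩ ht.1
  simp only [intervalIntegral.integral_const, smul_eq_mul, sub_zero] at e1 e2
  have e3 := intervalIntegral.integral_add_adjacent_intervals i1 i2
  have e4 := hF h0 hs' hs.1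
  rw [abs_of_nonneg (sub_nonneg.2 e4)]
  refine le_trans ?_ (le_abs_self _)
  nlinarith [hs.1, hs.2]

lemma AntitoneOn.half_mul_sub_le_integral {F : ℝ → ℝ} {m : ℝ} (hF : AntitoneOn F (Icc 0 m))
    {s : ℝ} (hs : s ∈ Icc 0 (m / 2)) :
    m / 2 * |F s - F 0| ≤ |(∫ t in (0 : ℝ)..m, F t) - m * F 0| := by
  have h := MonotoneOn.half_mul_sub_le_integral (F := fun t => -F t) hF.neg hs
  rw [intervalIntegral.integral_neg] at h
  rw [← abs_neg (F s - F 0), ← abs_neg (_ - m * F 0)]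
  convert h using 2 <;> ring_nf

lemma iteratedDerivWithin_Icc_subset {f : ℝ → ℝ} {a b c d y : ℝ} {k j : ℕ}
    (hf : ContDiffOn ℝ k f (Icc a b)) (hjk : j ≤ k) (hac : a ≤ c) (hcd : c < d) (hdb : d ≤ b)
    (hy : y ∈ Icc c d) :
    iteratedDerivWithin j f (Icc c d) y = iteratedDerivWithin j f (Icc a b) y := by
  simp only [iteratedDerivWithin]
  rw [iteratedFDerivWithin_subset (Icc_subset_Icc hac hdb) (uniqueDiffOn_Icc hcd)
    (uniqueDiffOn_Icc (by linarith)) (hf.of_le (by exact_mod_cast hjk)) hy]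

/-- By Darboux's theorem a derivative without zeros on an interval has constant sign. -/
lemma monotoneOn_or_antitoneOn_of_derivWithin_ne_zero {f : ℝ → ℝ} {c d : ℝ}
    (hf : DifferentiableOn ℝ f (Icc c d)) (hne : ∀ z ∈ Ioo c d, derivWithin f (Icc c d) z ≠ 0) :
    MonotoneOn f (Icc c d) ∨ AntitoneOn f (Icc c d) := by
  have hd : ∀ z ∈ Ioo c d, HasDerivAt f (derivWithin f (Icc c d) z) z := fun z hz =>
    (hf z (Ioo_subset_Icc_self hz)).hasDerivWithinAt.hasDerivAt (Icc_mem_nhds hz.1 hz.2)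
  rcases hasDerivWithinAt_forall_lt_or_forall_gt_of_forall_ne (convex_Ioo c d)
    (fun z hz => (hd z hz).hasDerivWithinAt) hne with h | h
  · right
    refine antitoneOn_of_deriv_nonpos (convex_Icc c d) hf.continuousOn ?_ ?_ <;>
      rw [interior_Icc]
    · exact fun z hz => (hd z hz).differentiableAt.differentiableWithinAt
    · exact fun z hz => by rw [(hd z hz).deriv]; exact (h z hz).le
  · left
    refine monotoneOn_of_deriv_nonneg (convex_Icc c d) hf.continuousOn ?_ ?_ <;>
      rw [interior_Icc]
    · exact fun z hz => (hd z hz).differentiableAt.differentiableWithinAt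
    · exact fun z hz => by rw [(hd z hz).deriv]; exact (h z hz).le

/-- Differentiating a Taylor polynomial gives that of the derivative; the factor `h` comes from the
chain rule. -/
lemma hasDerivAt_eval_taylorPoly (f : ℝ → ℝ) (s : Set ℝ) (x h t : ℝ) (r : ℕ) :
    ((taylorPoly f s x (r + 1)).comp (C h * X)).derivative.eval t =
      h * taylorWithinEval (derivWithin f s) r s x (x + h * t) := by
  have h1 := ((taylorPoly f s x (r + 1)).comp (C h * X)).hasDerivAt t
  have h2 : HasDerivAt (fun u : ℝ => x + h * u) h t := by
    simpa using ((hasDerivAt_id t).const_mul h).const_add x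
  have h3 := (hasDerivAt_taylorWithinEval_succ (s := s) (x₀ := x) (x := x + h * t) f r).comp t h2
  have h4 : (taylorWithinEval f (r + 1) s x ∘ fun u : ℝ => x + h * u) =
      fun u => ((taylorPoly f s x (r + 1)).comp (C h * X)).eval u := by
    funext u
    simp [eval_taylorPoly]
  rw [h4] at h3
  rw [h1.unique h3, mul_comm]

lemma taylorWithinEval_Icc_bound {f : ℝ → ℝ} {c d K : ℝ} {r : ℕ} (hcd : c ≤ d) (hK0 : 0 ≤ K)
    (hf : ContDiffOn ℝ (r + 1 : ℕ) f (Icc c d))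
    (hK : ∀ z ∈ Icc c d, |iteratedDerivWithin (r + 1) f (Icc c d) z| ≤ K)
    {z : ℝ} (hz : z ∈ Icc c d) :
    |f z - taylorWithinEval f r (Icc c d) c z| ≤ K * (d - c) ^ (r + 1) := by
  have h := taylor_mean_remainder_bound hcd (by exact_mod_cast hf) hz hK
  have h1 : (z - c) ^ (r + 1) ≤ (d - c) ^ (r + 1) :=
    pow_le_pow_left₀ (by linarith [hz.1]) (by linarith [hz.2]) _
  have h0 : 0 ≤ (z - c) ^ (r + 1) := pow_nonneg (by linarith [hz.1]) _
  have h2 : (1 : ℝ) ≤ r.factorial := by exact_mod_cast r.factorial_pos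
  refine h.trans ((div_le_self (mul_nonneg hK0 h0) h2).trans ?_)
  gcongr

/-- The error of the rule on the rescaled function is bounded by the correction, when the
derivative of the order of the error term is controlled by the first derivative. -/
lemma exists_trueError_bound_correction {n r : ℕ} (hn : 2 ≤ n) (hr : errOrder n = r + 2) :
    ∃ C G : ℝ, 0 < C ∧ 0 < G ∧ ∀ (M : ℝ) (f : ℝ → ℝ) (x h : ℝ), 0 < h → h ≤ 1 →
      G * M * h ≤ 1 / 2 →
      ContDiffOn ℝ (r + 2 : ℕ) f (Icc x (x + ((n : ℝ) - 1) * h)) →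
      (∀ z ∈ Ioo x (x + ((n : ℝ) - 1) * h),
        iteratedDerivWithin 1 f (Icc x (x + ((n : ℝ) - 1) * h)) z ≠ 0) →
      (∀ z ∈ Ioo x (x + ((n : ℝ) - 1) * h),
        |iteratedDerivWithin (r + 2) f (Icc x (x + ((n : ℝ) - 1) * h)) z| /
          |iteratedDerivWithin 1 f (Icc x (x + ((n : ℝ) - 1) * h)) z| ≤ M) →
      0 ≤ M ∧ correction n (fun t => f (x + h * t)) 0 1 ≠ 0 ∧
      |trueError n (fun t => f (x + h * t)) 0 1| ≤
        C * h ^ (r + 1) * M * |correction n (fun t => f (x + h * t)) 0 1| := by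
  have h2 : (2 : ℝ) ≤ n := by exact_mod_cast hn
  set m : ℝ := (n : ℝ) - 1 with hmdef
  have hm : 0 < m := by linarith
  obtain ⟨Λ, hΛ0, hΛ⟩ := exists_derivative_bound hm (r + 2)
  obtain ⟨K, hK0, hK⟩ := exists_trueError_bound (n := n) (by omega)
  refine ⟨4 * Λ * K * m ^ (r + 1), 2 * Λ * K * m ^ (r + 1) + Λ * m ^ (r + 2) + m ^ (r + 1),
    by positivity, by positivity, fun M f x h hpos hle hsmall hf hne hM => ?_⟩
  set s := Icc x (x + m * h) with hs
  set D := derivWithin f s with hD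
  have hmh : 0 < m * h := mul_pos hm hpos
  have hxX : x < x + m * h := by linarith
  have hu : UniqueDiffOn ℝ s := uniqueDiffOn_Icc hxX
  simp only [iteratedDerivWithin_one] at hne hM
  have hcD : ContDiffOn ℝ (r + 1 : ℕ) D s :=
    hf.derivWithin hu (by exact_mod_cast le_rfl)
  have hcP : ContinuousOn (iteratedDerivWithin (r + 2) f s) s :=
    hf.continuousOn_iteratedDerivWithin le_rfl hu
  -- Cleared of its denominator, the quotient bound extends by continuity to the endpoints, where
  -- `D` may vanish.
  have hMD : ∀ z ∈ s, |iteratedDerivWithin (r + 2) f s z| ≤ M * |D z| := by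
    have hcl : closure (Ioo x (x + m * h)) = s := closure_Ioo hxX.ne
    intro z hz
    refine le_on_closure (s := Ioo x (x + m * h)) (f := fun z => |iteratedDerivWithin (r + 2) f s z|)
      (g := fun z => M * |D z|) (fun y hy => ?_) (by rw [hcl]; exact hcP.abs)
      (by rw [hcl]; exact continuousOn_const.mul hcD.continuousOn.abs) (by rwa [hcl])
    exact (div_le_iff₀ (abs_pos.2 (hne y hy))).1 (hM y hy)
  have hmid : x + m * h / 2 ∈ Ioo x (x + m * h) := ⟨by linarith, by linarith⟩
  have hM0 : 0 ≤ M := le_trans (by positivity) (hM _ hmid)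
  obtain ⟨y, hy, hmax⟩ := isCompact_Icc.exists_isMaxOn (nonempty_Icc.2 hxX.le)
    hcD.continuousOn.abs
  set B := |D y| with hB
  have hmax' : ∀ z ∈ s, |D z| ≤ B := fun z hz => hmax hz
  have hB0 : 0 < B := (abs_pos.2 (hne _ hmid)).trans_le (hmax' _ (Ioo_subset_Icc_self hmid))
  have hPB : ∀ z ∈ s, |iteratedDerivWithin (r + 2) f s z| ≤ M * B := fun z hz =>
    (hMD z hz).trans (mul_le_mul_of_nonneg_left (hmax' z hz) hM0)
  have hMB : 0 ≤ M * B := mul_nonneg hM0 hB0.le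
  have hmaps : ∀ t ∈ Icc 0 m, x + h * t ∈ s := fun t ht =>
    ⟨by nlinarith [ht.1], by nlinarith [ht.2]⟩
  set P := (taylorPoly f s x (r + 1)).comp (C h * X) with hP
  have hPdeg : P.natDegree ≤ r + 1 := natDegree_comp_C_mul_X_le _ _ (natDegree_taylorPoly_le _ _ _ _)
  have hPlt : P.degree < (r + 2 : ℕ) :=
    lt_of_le_of_lt degree_le_natDegree (by exact_mod_cast Nat.lt_succ_of_le hPdeg)
  have hPe : ∀ t, P.eval t = taylorWithinEval f (r + 1) s x (x + h * t) := fun t => by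
    simp [hP, eval_taylorPoly]
  set e := M * B * (m * h) ^ (r + 2) with he
  have he0 : 0 ≤ e := by positivity
  have hFP : ∀ t ∈ Icc 0 m, |f (x + h * t) - P.eval t| ≤ e := fun t ht => by
    rw [hPe]
    have := taylorWithinEval_Icc_bound hxX.le hMB hf hPB (hmaps t ht)
    rwa [add_sub_cancel_left] at this
  have hDT : ∀ z ∈ s, |D z - taylorWithinEval D r s x z| ≤ M * B * (m * h) ^ (r + 1) :=
    fun z hz => by
      have := taylorWithinEval_Icc_bound hxX.le hMB hcD
        (fun z hz => by rw [← iteratedDerivWithin_succ']; exact hPB z hz) hz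
      rwa [add_sub_cancel_left] at this
  have hcF : ContinuousOn (fun t => f (x + h * t)) (Icc 0 m) :=
    hf.continuousOn.comp (by fun_prop) hmaps
  -- `P` has degree below `errOrder n`, so only the Taylor remainder contributes to the error.
  have herr : |trueError n (fun t => f (x + h * t)) 0 1| ≤ K * e := by
    have h1 := trueError_add n (f := fun t => f (x + h * t) - P.eval t) (g := fun t => P.eval t)
      (hcF.sub (Polynomial.continuous _).continuousOn) (Polynomial.continuous _).continuousOn
      (by omega)
    simp only [sub_add_cancel] at h1
    rw [h1, trueError_eval_of_degree_lt (by omega) le_rfl (hr ▸ hPlt), add_zero]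
    exact hK _ _ hFP
  set c := |correction n (fun t => f (x + h * t)) 0 1| with hc
  have hA : |(∫ t in (0 : ℝ)..m, f (x + h * t)) - m * f x| ≤ c + K * e := by
    have h1 := trueError_zero_one n (fun t => f (x + h * t))
    simp only [mul_zero, add_zero] at h1
    rw [← hmdef] at h1
    rw [show (∫ t in (0 : ℝ)..m, f (x + h * t)) - m * f x =
      correction n (fun t => f (x + h * t)) 0 1 + trueError n (fun t => f (x + h * t)) 0 1 by
        rw [h1]; ring]
    exact (abs_add_le _ _).trans (add_le_add le_rfl herr)
  have hmono : ∀ t ∈ Icc 0 (m / 2),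
      m / 2 * |f (x + h * t) - f x| ≤ |(∫ t in (0 : ℝ)..m, f (x + h * t)) - m * f x| := by
    intro t ht
    have haff : MonotoneOn (fun t => x + h * t) (Icc 0 m) := fun u _ v _ huv => by
      dsimp only; gcongr
    have hdf : DifferentiableOn ℝ f s := hf.differentiableOn (by positivity)
    rcases monotoneOn_or_antitoneOn_of_derivWithin_ne_zero hdf hne with hmon | hanti
    · have := MonotoneOn.half_mul_sub_le_integral (F := fun t => f (x + h * t))
        (hmon.comp haff hmaps) ht
      simpa using this
    · have := AntitoneOn.half_mul_sub_le_integral (F := fun t => f (x + h * t))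
        (fun u hu v hv huv => hanti (hmaps u hu) (hmaps v hv) (haff hu hv huv)) ht
      simpa using this
  -- Monotonicity makes the rescaled `f` nearly constant on the half panel, and `P` inherits this up
  -- to the remainder `e`.
  have hQ : ∀ t ∈ Icc 0 (m / 2), |(P - C (f x)).eval t| ≤ 2 / m * (c + K * e) + e := by
    intro t ht
    have h1 := (hmono t ht).trans hA
    have h3 : |f (x + h * t) - f x| ≤ 2 / m * (c + K * e) := by
      rw [div_mul_eq_mul_div, le_div_iff₀ hm]
      linarith
    have h4 := hFP t ⟨ht.1, by linarith [ht.2]⟩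
    rw [eval_sub, eval_C]
    have h5 := abs_sub_le (P.eval t) (f (x + h * t)) (f x)
    rw [abs_sub_comm (P.eval t) (f (x + h * t))] at h5
    linarith
  -- The derivative bound is used at the parameter of the point `y` where `|D|` attains its maximum
  -- `B`.
  have ht : (y - x) / h ∈ Icc 0 m :=
    ⟨div_nonneg (by linarith [hy.1]) hpos.le, by rw [div_le_iff₀ hpos]; linarith [hy.2]⟩
  have hder := hΛ (P - C (f x)) _
    (lt_of_le_of_lt (degree_sub_le _ _) (max_lt hPlt
      (lt_of_le_of_lt degree_C_le (by exact_mod_cast Nat.succ_pos _)))) hQ _ ht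
  rw [derivative_sub, derivative_C, sub_zero, hP, hasDerivAt_eval_taylorPoly,
    mul_div_cancel₀ _ hpos.ne', add_sub_cancel, abs_mul, abs_of_pos hpos] at hder
  have hBle : B ≤ |taylorWithinEval D r s x y| + M * B * (m * h) ^ (r + 1) := by
    have h1 := hDT y hy
    have h3 := abs_sub_abs_le_abs_sub (D y) (taylorWithinEval D r s x y)
    linarith
  have hhB : h * B ≤ Λ * (2 / m * (c + K * e) + e) + h * (M * B * (m * h) ^ (r + 1)) := by
    have := mul_le_mul_of_nonneg_left hBle hpos.le
    linarith
  have hexp : Λ * (2 / m * (c + K * e) + e) + h * (M * B * (m * h) ^ (r + 1)) =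
      2 * Λ / m * c + (2 * Λ * K * m ^ (r + 1) + Λ * m ^ (r + 2) + m ^ (r + 1)) * M * h ^ (r + 1) *
        (h * B) := by
    rw [he]
    field_simp
    ring_nf
  have hpow : h ^ (r + 1) ≤ h := pow_le_of_le_one hpos.le hle (by omega)
  -- The remainders in `hexp` are a multiple of `h * B`. With coefficient at most `1 / 2` they are
  -- absorbed on the left, which doubles the constant `2 * Λ / m`.
  have hhalf : (2 * Λ * K * m ^ (r + 1) + Λ * m ^ (r + 2) + m ^ (r + 1)) * M * h ^ (r + 1) ≤
      1 / 2 := le_trans (by gcongr) hsmall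
  have hhB0 : 0 < h * B := mul_pos hpos hB0
  have hfin : h * B ≤ 4 * Λ / m * c := by
    rw [hexp] at hhB
    have := mul_le_mul_of_nonneg_right hhalf hhB0.le
    have h4 : 4 * Λ / m * c = 2 * (2 * Λ / m * c) := by ring
    linarith
  refine ⟨hM0, fun h0 => ?_, herr.trans ?_⟩
  · rw [hc, h0, abs_zero, mul_zero] at hfin
    linarith
  · calc K * e = K * M * m ^ (r + 2) * h ^ (r + 1) * (h * B) := by rw [he, mul_pow]; ring
      _ ≤ K * M * m ^ (r + 2) * h ^ (r + 1) * (4 * Λ / m * c) := by gcongr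
      _ = 4 * Λ * K * m ^ (r + 1) * h ^ (r + 1) * M * c := by field_simp; ring

lemma exists_uniform_trueError_bound {n : ℕ} (hn : 2 ≤ n) :
    ∃ C : ℝ, 0 < C ∧ ∀ M : ℝ, ∃ h₀ : ℝ, 0 < h₀ ∧
      ∀ (a b : ℝ) (f : ℝ → ℝ) (x h : ℝ), ContDiffOn ℝ (errOrder n : ℕ) f (Icc a b) →
        a ≤ x → 0 < h → h < h₀ → x + ((n : ℝ) - 1) * h ≤ b →
        (∀ z ∈ Ioo x (x + ((n : ℝ) - 1) * h), iteratedDerivWithin 1 f (Icc a b) z ≠ 0) →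
        (∀ z ∈ Ioo x (x + ((n : ℝ) - 1) * h), |iteratedDerivWithin (errOrder n) f (Icc a b) z| /
            |iteratedDerivWithin 1 f (Icc a b) z| ≤ M) →
        correction n f x h ≠ 0 ∧
        |trueError n f x h| ≤ C * h ^ (n - 1) * M * |correction n f x h| ∧
        |trueError n f x h| ≤ |newtonInt n h (errOrder n)| /
          (((errOrder n).factorial : ℝ) * newtonInt n h 1 * h) * M * |correction n f x h| := by
  have hp := le_errOrder n
  obtain ⟨r, hr⟩ : ∃ r, errOrder n = r + 2 := ⟨errOrder n - 2, by omega⟩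
  obtain ⟨C, G, hC, hG, hmain⟩ := exists_trueError_bound_correction hn hr
  have h2 : (2 : ℝ) ≤ n := by exact_mod_cast hn
  have hm : 0 < (n : ℝ) - 1 := by linarith
  have hI1 : 0 < newtonInt n 1 1 := by rw [newtonInt_one]; positivity
  have hIp : 0 < |newtonInt n 1 (errOrder n)| := abs_pos.2 (newtonInt_errOrder_ne_zero hn)
  set κ := |newtonInt n 1 (errOrder n)| / (((errOrder n).factorial : ℝ) * newtonInt n 1 1) with hκ
  have hκ0 : 0 < κ := by positivity
  -- The second entry ensures `G * M * h ≤ 1 / 2`, with `|M| + 1` keeping it positive for every real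
  -- `M`. The third gives `C * h ≤ κ`, trading the spare power of `h` for the explicit constant; it
  -- is positive because `I(w_p) ≠ 0`.
  refine ⟨C, hC, fun M => ⟨min 1 (min (1 / (2 * G * (|M| + 1))) (κ / C)),
    by positivity, fun a b f x h hf hax hpos hlt hxb hne hM => ?_⟩⟩
  obtain ⟨hl1, hl2, hl3⟩ : h < 1 ∧ h < 1 / (2 * G * (|M| + 1)) ∧ h < κ / C := by
    simpa only [lt_min_iff] using hlt
  have hsmall : G * M * h ≤ 1 / 2 := by
    rw [lt_div_iff₀ (by positivity)] at hl2
    have := mul_le_mul_of_nonneg_left (le_abs_self M) (mul_pos hG hpos).le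
    nlinarith [mul_pos hG hpos]
  have hxX : x < x + ((n : ℝ) - 1) * h := by nlinarith
  have hsub := fun j (hj : j ≤ errOrder n) z
      (hz : z ∈ Ioo x (x + ((n : ℝ) - 1) * h)) =>
    iteratedDerivWithin_Icc_subset hf hj hax hxX hxb (Ioo_subset_Icc_self hz)
  obtain ⟨hM0, hc0, hle⟩ := hmain M f x h hpos hl1.le hsmall
    (hr ▸ hf.mono (Icc_subset_Icc hax hxb))
    (fun z hz => by rw [hsub 1 (by omega) z hz]; exact hne z hz)
    (fun z hz => by
      rw [hsub 1 (by omega) z hz, hsub (r + 2) hr.ge z hz, ← hr]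
      exact hM z hz)
  have hle' : |trueError n f x h| ≤ C * h ^ (r + 1) * M * |correction n f x h| := by
    rw [trueError_scale n f x hpos.ne', correction_scale n f x hpos.ne', abs_mul, abs_mul,
      mul_left_comm]
    gcongr
  refine ⟨?_, hle'.trans ?_, hle'.trans ?_⟩
  · rw [correction_scale n f x hpos.ne']
    exact mul_ne_zero hpos.ne' hc0
  · have : h ^ (r + 1) ≤ h ^ (n - 1) := pow_le_pow_of_le_one hpos.le hl1.le (by omega)
    gcongr
  · have hfac : |newtonInt n h (errOrder n)| /
        (((errOrder n).factorial : ℝ) * newtonInt n h 1 * h) = κ * h ^ r := by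
      rw [newtonInt_scale n _ h, newtonInt_scale n 1 h, abs_mul, abs_of_pos (pow_pos hpos _), hκ,
        show h ^ (errOrder n + 1) = h ^ r * h ^ 3 by rw [hr]; ring]
      field_simp
    rw [hfac]
    have h3 : C * h ≤ κ := by
      rw [lt_div_iff₀ hC] at hl3
      linarith
    have : C * h ^ (r + 1) ≤ κ * h ^ r := by
      calc C * h ^ (r + 1) = C * h * h ^ r := by ring
        _ ≤ κ * h ^ r := by gcongr
    gcongr

end ModelA

end

theorem proposition3p1 (n : ℕ) (hn : 2 ≤ n) :
    -- the error bound, with constants that do not depend on `f`, the panel or the step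
    (∃ C : ℝ, 0 < C ∧ ∀ M : ℝ, ∃ h₀ : ℝ, 0 < h₀ ∧
      ∀ (a b : ℝ) (f : ℝ → ℝ) (x₁ h : ℝ),
        ContDiffOn ℝ (ModelA.errOrder n : ℕ) f (Set.Icc a b) →
        a ≤ x₁ → 0 < h → h < h₀ → x₁ + ((n : ℝ) - 1) * h ≤ b →
        ModelA.PanelCondition n f (Set.Icc a b) x₁ h →
        (∀ x ∈ Set.Ioo x₁ (x₁ + ((n : ℝ) - 1) * h),
          |iteratedDerivWithin (ModelA.errOrder n) f (Set.Icc a b) x| /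
            |iteratedDerivWithin 1 f (Set.Icc a b) x| ≤ M) →
        ModelA.correction n f x₁ h ≠ 0 ∧
        |ModelA.trueError n f x₁ h| ≤ C * h ^ (n - 1) * M * |ModelA.correction n f x₁ h| ∧
        |ModelA.trueError n f x₁ h| ≤
          |ModelA.newtonInt n h (ModelA.errOrder n)| /
            (((ModelA.errOrder n).factorial : ℝ) * ModelA.newtonInt n h 1 * h) * M *
              |ModelA.correction n f x₁ h|) ∧
    -- the correction is realistic: the true error is much smaller, as the step tends to zero
    (∀ (a b : ℝ) (f : ℝ → ℝ) (x₁ : ℝ),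
      ContDiffOn ℝ (ModelA.errOrder n : ℕ) f (Set.Icc a b) → a ≤ x₁ → x₁ < b →
      (∃ j : ℕ, 1 ≤ j ∧ j < ModelA.errOrder n ∧
        iteratedDerivWithin j f (Set.Icc a b) x₁ ≠ 0) →
      ∀ η : ℝ, 0 < η → ∃ h₀ : ℝ, 0 < h₀ ∧ ∀ h : ℝ, 0 < h → h < h₀ →
        x₁ + ((n : ℝ) - 1) * h ≤ b → ModelA.PanelCondition n f (Set.Icc a b) x₁ h →
        ModelA.correction n f x₁ h ≠ 0 ∧
        |ModelA.trueError n f x₁ h| ≤ η * |ModelA.correction n f x₁ h|) ∧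
    -- the estimates of the true error of the corrected rule
    (∀ (a b : ℝ) (f : ℝ → ℝ) (x₁ : ℝ),
      ContDiffOn ℝ (ModelA.errOrder n : ℕ) f (Set.Icc a b) → a ≤ x₁ → x₁ < b →
      iteratedDerivWithin 1 f (Set.Icc a b) x₁ ≠ 0 →
      ∀ η : ℝ, 0 < η → ∃ h₀ : ℝ, 0 < h₀ ∧ ∀ h : ℝ, 0 < h → h < h₀ →
        x₁ + ((n : ℝ) - 1) * h ≤ b → ModelA.PanelCondition n f (Set.Icc a b) x₁ h →
        |ModelA.trueError n f x₁ h - ModelA.errorEstimate n f x₁ h| ≤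
          η * h ^ (ModelA.errOrder n + 1) ∧
        (iteratedDerivWithin (ModelA.errOrder n) f (Set.Icc a b) x₁ ≠ 0 →
          |ModelA.trueError n f x₁ h - ModelA.errorEstimate n f x₁ h| ≤
            η * |ModelA.trueError n f x₁ h| ∧
          ModelA.IsRealisticEstimate (ModelA.trueError n f x₁ h)
            (ModelA.errorEstimate n f x₁ h))) := by
  obtain ⟨C, hC, hbound⟩ := ModelA.exists_uniform_trueError_bound hn
  refine ⟨⟨C, hC, fun M => ?_⟩, ?_, ?_⟩
  · obtain ⟨h₀, hh₀, hmain⟩ := hbound M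
    exact ⟨h₀, hh₀, fun a b f x₁ h hf hax hpos hlt hxb hpanel hM =>
      hmain a b f x₁ h hf hax hpos hlt hxb hpanel.1 hM⟩
  · intro a b f x₁ hf hax hxb hj η hη
    obtain ⟨h₀, hh₀, hmain⟩ := ModelA.exists_trueError_le_correction hn hf hax hxb hj hη
    exact ⟨h₀, hh₀, fun h hpos hlt _ _ => hmain h hpos hlt⟩
  · intro a b f x₁ hf hax hxb h1 η hη
    obtain ⟨h₀, hh₀, hmain⟩ := ModelA.exists_trueError_sub_errorEstimate_le hn hf hax hxb h1 hη
    exact ⟨h₀, hh₀, fun h hpos hlt _ _ => hmain h hpos hlt⟩
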